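/- Let $\alpha\in(0,2]$, let $n\ge 0$ be an integer, and let $P_n$ denote the Jacobi polynomial of degree $n$ with both parameters equal to $\alpha/2$, normalized by $P_n(1)=1$; that is, $(P_n)_{n\ge0}$ is the sequence of polynomials with $\deg P_n=n$, $P_n(1)=1$ and $\int_{-1}^1(1-x^2)^{\alpha/2}P_m(x)P_n(x)\,dx=0$ for $m\neq n$, equivalently $P_n(x)={}_2F_1\left(-n,n+\alpha+1;\tfrac{\alpha}{2}+1;\tfrac{1-x}{2}\right)$. For a function $y:\mathbb{R}\to\mathbb{R}$ and $\alpha\in(0,2)$ put $$(-\Delta)^{\alpha/2}y(x)=\frac{1}{\eta(\alpha)}\lim_{\varepsilon\to0^+}\int_{\mathbb{R}\setminus(-\varepsilon,\varepsilon)}\frac{y(x)-y(x-t)}{|t|^{1+\alpha}}\,dt,\qquad \eta(\alpha)=-\frac{\pi^{1/2}\,\Gamma(-\alpha/2)}{2^{\alpha}\,\Gamma((1+\alpha)/2)},$$ and for $\alpha=2$ put $(-\Delta)^{\alpha/2}y(x)=-y''(x)$. Define $y_n(x)=(1-x^2)_+^{\alpha/2}P_n(x)$ for $x\in\mathbb{R}$,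 where $a_+=\max(a,0)$. Then for every $n\ge0$ and every $x\in(-1,1)$ the value $(-\Delta)^{\alpha/2}y_n(x)$ exists and $$(-\Delta)^{\alpha/2}y_n(x)=\mu_n\,P_n(x),\qquad \mu_n=\frac{\Gamma(n+\alpha+1)}{\Gamma(n+1)}.$$ -/

import Mathlib

/-- The Jacobi polynomial of degree `n` with parameters `β`, `γ`, normalized to take the value `1`
at the point `1`, that is, the terminating Gauss series
`₂F₁(-n, n + β + γ + 1; β + 1; (1 - X) / 2)`.
The three theorems `natDegree_jacobi`, `eval_one_jacobi` and `integral_jacobi_mul_jacobi` below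
show that, for `β, γ > -1`, these are the polynomials of exact degree `n` that are orthogonal on
`(-1, 1)` for the weight `(1 - x) ^ β * (1 + x) ^ γ` and equal to `1` at `1`. -/
noncomputable def jacobi (β γ : ℝ) (n : ℕ) : Polynomial ℝ :=
  ∑ k ∈ Finset.range (n + 1),
    Polynomial.C ((ascPochhammer ℝ k).eval (-(n : ℝ)) *
        (ascPochhammer ℝ k).eval ((n : ℝ) + β + γ + 1) /
        ((ascPochhammer ℝ k).eval (β + 1) * (k.factorial : ℝ))) *
      (Polynomial.C (1 / 2) * (1 - Polynomial.X)) ^ k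

/-- The constant `η(α)` of the one-dimensional fractional Laplacian of order `α ∈ (0, 2)`. -/
noncomputable def fracLaplacianEta (α : ℝ) : ℝ :=
  -(Real.sqrt Real.pi * Real.Gamma (-(α / 2))) /
    ((2 : ℝ) ^ α * Real.Gamma ((1 + α) / 2))

/-- `HasFracLaplacianAt α y x L` : the fractional Laplacian `(-Δ)^(α/2)` of `y : ℝ → ℝ` exists at
the point `x` and has the value `L`.
For `α = 2` this is `-y''(x)`, and existence means that `y` is differentiable near `x` and `y'` is
differentiable at `x`.  For the other orders it is the principal value
`η(α)⁻¹ * lim_{ε → 0+} ∫_{ℝ ∖ (-ε, ε)} (y(x) - y(x - t)) / |t|^(1+α) dt`, and existence means that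
all the truncated integrals converge absolutely and that the limit exists. -/
def HasFracLaplacianAt (α : ℝ) (y : ℝ → ℝ) (x L : ℝ) : Prop :=
  (α = 2 ∧ ∃ y' : ℝ → ℝ, (∀ᶠ z in nhds x, HasDerivAt y (y' z) z) ∧ HasDerivAt y' (-L) x) ∨
  (α ≠ 2 ∧
    (∀ ε : ℝ, 0 < ε → MeasureTheory.IntegrableOn
      (fun t : ℝ => (y x - y (x - t)) / |t| ^ (1 + α)) (Set.Ioo (-ε) ε)ᶜ MeasureTheory.volume) ∧
    Filter.Tendsto
      (fun ε : ℝ => 1 / fracLaplacianEta α *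
        ∫ t in (Set.Ioo (-ε) ε)ᶜ, (y x - y (x - t)) / |t| ^ (1 + α))
      (nhdsWithin 0 (Set.Ioi 0)) (nhds L))

/-! ### The polynomials `jacobi β γ n` are the normalized orthogonal polynomials -/

theorem eval_one_jacobi (β γ : ℝ) (n : ℕ) : (jacobi β γ n).eval 1 = 1 := by
  unfold jacobi
  rw [Finset.sum_range_succ', Polynomial.eval_add, Polynomial.eval_finsetSum]
  simp

theorem natDegree_jacobi {β γ : ℝ} (hβ : -1 < β) (hγ : -1 < γ) (n : ℕ) :
    (jacobi β γ n).natDegree = n := by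
  have hlin : (Polynomial.C (1 / 2 : ℝ) * (1 - Polynomial.X)).natDegree = 1 := by
    have : (Polynomial.C (1 / 2 : ℝ) * (1 - Polynomial.X)) =
        Polynomial.C (-1 / 2) * Polynomial.X + Polynomial.C (1 / 2) := by
      rw [show (-1 / 2 : ℝ) = -(1 / 2) by norm_num, Polynomial.C_neg]; ring
    rw [this]
    exact Polynomial.natDegree_linear (by norm_num)
  have hterm : ∀ (c : ℝ) (k : ℕ),
      (Polynomial.C c * (Polynomial.C (1 / 2 : ℝ) * (1 - Polynomial.X)) ^ k).natDegree ≤ k := by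
    intro c k
    refine (Polynomial.natDegree_C_mul_le _ _).trans ?_
    rw [Polynomial.natDegree_pow, hlin, mul_one]
  have h1 : (ascPochhammer ℝ n).eval (-(n : ℝ)) ≠ 0 := by
    rw [Ne, ascPochhammer_eval_eq_zero_iff]
    rintro ⟨k, hk, h⟩
    have : (k : ℝ) = n := by linarith
    exact hk.ne (by exact_mod_cast this)
  have h2 : (ascPochhammer ℝ n).eval ((n : ℝ) + β + γ + 1) ≠ 0 := by
    rcases Nat.eq_zero_or_pos n with rfl | hn
    · simp
    · have : (1 : ℝ) ≤ n := by exact_mod_cast hn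
      exact (ascPochhammer_pos n _ (by linarith)).ne'
  have h3 : (ascPochhammer ℝ n).eval (β + 1) ≠ 0 :=
    (ascPochhammer_pos n _ (by linarith)).ne'
  have h4 : ((n.factorial : ℕ) : ℝ) ≠ 0 := by exact_mod_cast n.factorial_ne_zero
  unfold jacobi
  rw [Finset.sum_range_succ]
  have hlast : ∀ c : ℝ, c ≠ 0 →
      (Polynomial.C c * (Polynomial.C (1 / 2 : ℝ) * (1 - Polynomial.X)) ^ n).natDegree = n := by
    intro c hc
    rw [Polynomial.natDegree_C_mul hc, Polynomial.natDegree_pow, hlin, mul_one]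
  have hc := hlast _ (div_ne_zero (mul_ne_zero h1 h2) (mul_ne_zero h3 h4))
  rcases Nat.eq_zero_or_pos n with rfl | hn
  · simp
  · rw [Polynomial.natDegree_add_eq_right_of_natDegree_lt]
    · exact hc
    · rw [hc]
      refine lt_of_le_of_lt
        (Polynomial.natDegree_sum_le_of_forall_le (n := n - 1) _ _ ?_) (by omega)
      intro k hk
      have := Finset.mem_range.1 hk
      exact (hterm _ _).trans (by omega)

theorem gamma_add_nat_eq {s : ℝ} (hs : 0 < s) (k : ℕ) :
    Real.Gamma (s + k) = (ascPochhammer ℝ k).eval s * Real.Gamma s := by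
  induction k with
  | zero => simp
  | succ k ih =>
    have : s + (k : ℝ) ≠ 0 := by positivity
    rw [ascPochhammer_succ_eval, Nat.cast_succ, ← add_assoc, Real.Gamma_add_one this, ih]
    ring

theorem beta_moment {a b : ℝ} (ha : 0 < a) (hb : 0 < b) :
    IntervalIntegrable (fun u : ℝ => u ^ (a - 1) * (1 - u) ^ (b - 1)) MeasureTheory.volume 0 1 ∧
    ∫ u in (0 : ℝ)..1, u ^ (a - 1) * (1 - u) ^ (b - 1) =
      Real.Gamma a * Real.Gamma b / Real.Gamma (a + b) := by
  have hcast : Set.EqOn (fun x : ℝ => (x : ℂ) ^ ((a : ℂ) - 1) * (1 - (x : ℂ)) ^ ((b : ℂ) - 1))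
      (fun u : ℝ => ((u ^ (a - 1) * (1 - u) ^ (b - 1) : ℝ) : ℂ)) (Set.uIcc 0 1) := by
    intro u hu
    rw [Set.uIcc_of_le zero_le_one] at hu
    simp only
    rw [Complex.ofReal_mul, Complex.ofReal_cpow hu.1, Complex.ofReal_cpow (by linarith [hu.2])]
    push_cast
    rfl
  have hint := Complex.betaIntegral_convergent (u := a) (v := b) (by simpa) (by simpa)
  have hval := Complex.betaIntegral_eq_Gamma_mul_div a b (by simpa) (by simpa)
  constructor
  · have h2 : IntervalIntegrable
        (fun u : ℝ => ((u ^ (a - 1) * (1 - u) ^ (b - 1) : ℝ) : ℂ)) MeasureTheory.volume 0 1 :=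
      hint.congr (hcast.mono Set.uIoc_subset_uIcc)
    have h3 : IntervalIntegrable
        (fun u : ℝ => (((u ^ (a - 1) * (1 - u) ^ (b - 1) : ℝ) : ℂ)).re)
        MeasureTheory.volume 0 1 := ⟨h2.1.re, h2.2.re⟩
    simpa only [Complex.ofReal_re] using h3
  · unfold Complex.betaIntegral at hval
    rw [intervalIntegral.integral_congr hcast, intervalIntegral.integral_ofReal,
      ← Complex.ofReal_add, Complex.Gamma_ofReal, Complex.Gamma_ofReal, Complex.Gamma_ofReal]
      at hval
    exact_mod_cast hval

theorem jacobi_moment {β γ : ℝ} (hβ : -1 < β) (hγ : -1 < γ) (k j : ℕ) :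
    IntervalIntegrable (fun x : ℝ => (1 - x) ^ β * (1 + x) ^ γ *
      (((1 - x) / 2) ^ k * ((1 + x) / 2) ^ j)) MeasureTheory.volume (-1) 1 ∧
    ∫ x in (-1 : ℝ)..1, (1 - x) ^ β * (1 + x) ^ γ * (((1 - x) / 2) ^ k * ((1 + x) / 2) ^ j) =
      2 * ((2 : ℝ) ^ β * 2 ^ γ) * (Real.Gamma (γ + 1 + j) * Real.Gamma (β + 1 + k) /
        Real.Gamma (γ + 1 + j + (β + 1 + k))) := by
  have ha : 0 < γ + 1 + (j : ℝ) := by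
    have : (0 : ℝ) ≤ j := j.cast_nonneg
    linarith
  have hb : 0 < β + 1 + (k : ℝ) := by
    have : (0 : ℝ) ≤ k := k.cast_nonneg
    linarith
  obtain ⟨hi, hv⟩ := beta_moment ha hb
  set F : ℝ → ℝ := fun x => (1 - x) ^ β * (1 + x) ^ γ *
      (((1 - x) / 2) ^ k * ((1 + x) / 2) ^ j) with hF
  have hEq : Set.EqOn (fun u : ℝ => ((2 : ℝ) ^ β * 2 ^ γ) *
      (u ^ (γ + 1 + (j : ℝ) - 1) * (1 - u) ^ (β + 1 + (k : ℝ) - 1)))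
      (fun u => F (2 * u - 1)) (Set.Ioo 0 1) := by
    intro u hu
    have h0 : 0 < u := hu.1
    have h1 : 0 < 1 - u := by linarith [hu.2]
    simp only [hF]
    rw [show γ + 1 + (j : ℝ) - 1 = γ + j by ring, show β + 1 + (k : ℝ) - 1 = β + k by ring,
      Real.rpow_add h0, Real.rpow_add h1, Real.rpow_natCast, Real.rpow_natCast,
      show 1 - (2 * u - 1) = 2 * (1 - u) by ring, show 1 + (2 * u - 1) = 2 * u by ring,
      Real.mul_rpow (by norm_num) h1.le, Real.mul_rpow (by norm_num) h0.le,
      mul_div_cancel_left₀ _ (two_ne_zero), mul_div_cancel_left₀ _ (two_ne_zero)]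
    ring
  have hEq' : Set.EqOn (fun u : ℝ => ((2 : ℝ) ^ β * 2 ^ γ) *
      (u ^ (γ + 1 + (j : ℝ) - 1) * (1 - u) ^ (β + 1 + (k : ℝ) - 1)))
      (fun u => F (2 * u - 1)) (Set.uIoo 0 1) := by
    rwa [Set.uIoo_of_le zero_le_one]
  have hG : IntervalIntegrable (fun u => F (2 * u - 1)) MeasureTheory.volume 0 1 :=
    (hi.const_mul ((2 : ℝ) ^ β * 2 ^ γ)).congr_uIoo hEq'
  constructor
  · have h1 := (hG.comp_mul_left (c := 1 / 2)).comp_add_right 1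
    norm_num at h1
    refine h1.congr ?_
    intro x _
    simp only
    congr 1
    ring
  · have h1 := intervalIntegral.integral_comp_mul_sub (a := 0) (b := 1) F (two_ne_zero) 1
    rw [show (2 : ℝ) * 0 - 1 = -1 by norm_num, show (2 : ℝ) * 1 - 1 = 1 by norm_num,
      smul_eq_mul] at h1
    have h2 : ∫ u in (0 : ℝ)..1, F (2 * u - 1) = ((2 : ℝ) ^ β * 2 ^ γ) *
        (Real.Gamma (γ + 1 + j) * Real.Gamma (β + 1 + k) /
          Real.Gamma (γ + 1 + j + (β + 1 + k))) := by
      rw [← hv, ← intervalIntegral.integral_const_mul]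
      exact (intervalIntegral.integral_congr_uIoo hEq').symm
    rw [h2] at h1
    linarith

theorem ascPochhammer_neg_div_factorial (n k : ℕ) :
    (ascPochhammer ℝ k).eval (-(n : ℝ)) = (-1) ^ k * (n.choose k : ℝ) * (k.factorial : ℝ) := by
  rw [ascPochhammer_eval_neg_eq_descPochhammer, descPochhammer_eval_eq_descFactorial,
    Nat.descFactorial_eq_factorial_mul_choose]
  push_cast
  ring

theorem sum_jacobi_moment {β γ : ℝ} (hβ : -1 < β) (hγ : -1 < γ) {n j : ℕ} (hj : j < n) :
    ∑ k ∈ Finset.range (n + 1), (ascPochhammer ℝ k).eval (-(n : ℝ)) *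
        (ascPochhammer ℝ k).eval ((n : ℝ) + β + γ + 1) /
        ((ascPochhammer ℝ k).eval (β + 1) * (k.factorial : ℝ)) *
      (Real.Gamma (γ + 1 + j) * Real.Gamma (β + 1 + k) /
        Real.Gamma (γ + 1 + j + (β + 1 + k))) = 0 := by
  have hn : (1 : ℝ) ≤ n := by exact_mod_cast (by omega : 1 ≤ n)
  have hs : 0 < (n : ℝ) + β + γ + 1 := by linarith
  have hq : 0 < β + 1 := by linarith
  have hj0 : (0 : ℝ) ≤ j := j.cast_nonneg
  have ht : 0 < γ + 1 + (j : ℝ) + (β + 1) := by linarith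
  set P : Polynomial ℝ := (ascPochhammer ℝ (n - 1 - j)).comp
    (Polynomial.X + Polynomial.C (γ + 1 + (j : ℝ) + (β + 1))) with hP
  have hPd : P.natDegree < n := by
    rw [hP, Polynomial.natDegree_comp, ascPochhammer_natDegree, Polynomial.natDegree_X_add_C]
    omega
  have hdiff := congrFun (Polynomial.fwdDiff_iter_eq_zero_of_degree_lt hPd) 0
  rw [fwdDiff_iter_eq_sum_shift] at hdiff
  have hkey : ∀ k ∈ Finset.range (n + 1), (ascPochhammer ℝ k).eval (-(n : ℝ)) *
        (ascPochhammer ℝ k).eval ((n : ℝ) + β + γ + 1) /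
        ((ascPochhammer ℝ k).eval (β + 1) * (k.factorial : ℝ)) *
      (Real.Gamma (γ + 1 + j) * Real.Gamma (β + 1 + k) /
        Real.Gamma (γ + 1 + j + (β + 1 + k))) =
      ((-1) ^ n * (Real.Gamma (γ + 1 + j) * Real.Gamma (β + 1) /
        Real.Gamma ((n : ℝ) + β + γ + 1))) *
        (((-1 : ℤ) ^ (n - k) * (n.choose k : ℤ)) • P.eval (0 + k • (1 : ℝ))) := by
    intro k hk
    have hkn : k ≤ n := by have := Finset.mem_range.1 hk; omega
    have hk0 : (0 : ℝ) ≤ k := k.cast_nonneg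
    have e1 : (ascPochhammer ℝ k).eval ((n : ℝ) + β + γ + 1) =
        Real.Gamma ((n : ℝ) + β + γ + 1 + k) / Real.Gamma ((n : ℝ) + β + γ + 1) := by
      rw [gamma_add_nat_eq hs, mul_div_cancel_right₀ _ (Real.Gamma_pos_of_pos hs).ne']
    have e2 : Real.Gamma ((n : ℝ) + β + γ + 1 + k) =
        P.eval (0 + k • (1 : ℝ)) * Real.Gamma (γ + 1 + j + (β + 1 + k)) := by
      have := gamma_add_nat_eq (s := γ + 1 + j + (β + 1 + k)) (by linarith) (n - 1 - j)
      rw [show (n : ℝ) + β + γ + 1 + k = γ + 1 + j + (β + 1 + k) + ((n - 1 - j : ℕ) : ℝ) by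
        rw [Nat.cast_sub (by omega), Nat.cast_sub (by omega)]; push_cast; ring, this, hP]
      simp only [Polynomial.eval_comp, Polynomial.eval_add, Polynomial.eval_X, Polynomial.eval_C]
      congr 2
      simp
      ring
    have hsign : (-1 : ℝ) ^ k = (-1) ^ n * (-1) ^ (n - k) := by
      rw [← pow_add, show n + (n - k) = 2 * (n - k) + k by omega, pow_add, pow_mul]
      simp
    have f1 : Real.Gamma (γ + 1 + j + (β + 1 + k)) ≠ 0 :=
      (Real.Gamma_pos_of_pos (by linarith)).ne'
    have f2 : (ascPochhammer ℝ k).eval (β + 1) ≠ 0 := (ascPochhammer_pos k _ hq).ne'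
    have f3 : ((k.factorial : ℕ) : ℝ) ≠ 0 := by exact_mod_cast k.factorial_ne_zero
    have f4 : Real.Gamma ((n : ℝ) + β + γ + 1) ≠ 0 := (Real.Gamma_pos_of_pos hs).ne'
    rw [ascPochhammer_neg_div_factorial, e1, e2, gamma_add_nat_eq hq, hsign, zsmul_eq_mul]
    push_cast
    field_simp
  rw [Finset.sum_congr rfl hkey, ← Finset.mul_sum, hdiff]
  simp

theorem eval_jacobi (β γ : ℝ) (n : ℕ) (x : ℝ) :
    (jacobi β γ n).eval x = ∑ k ∈ Finset.range (n + 1),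
      (ascPochhammer ℝ k).eval (-(n : ℝ)) *
        (ascPochhammer ℝ k).eval ((n : ℝ) + β + γ + 1) /
        ((ascPochhammer ℝ k).eval (β + 1) * (k.factorial : ℝ)) * ((1 - x) / 2) ^ k := by
  unfold jacobi
  rw [Polynomial.eval_finsetSum]
  refine Finset.sum_congr rfl fun k _ => ?_
  simp only [Polynomial.eval_mul, Polynomial.eval_C, Polynomial.eval_pow, Polynomial.eval_sub,
    Polynomial.eval_one, Polynomial.eval_X]
  rw [show 1 / 2 * (1 - x) = (1 - x) / 2 by ring]

theorem jacobi_orth_pow {β γ : ℝ} (hβ : -1 < β) (hγ : -1 < γ) (n j : ℕ) :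
    IntervalIntegrable (fun x : ℝ => (1 - x) ^ β * (1 + x) ^ γ *
      ((jacobi β γ n).eval x * ((1 + x) / 2) ^ j)) MeasureTheory.volume (-1) 1 ∧
    (j < n → ∫ x in (-1 : ℝ)..1, (1 - x) ^ β * (1 + x) ^ γ *
      ((jacobi β γ n).eval x * ((1 + x) / 2) ^ j) = 0) := by
  set c : ℕ → ℝ := fun k => (ascPochhammer ℝ k).eval (-(n : ℝ)) *
        (ascPochhammer ℝ k).eval ((n : ℝ) + β + γ + 1) /
        ((ascPochhammer ℝ k).eval (β + 1) * (k.factorial : ℝ)) with hc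
  have hfun : (fun x : ℝ => (1 - x) ^ β * (1 + x) ^ γ *
      ((jacobi β γ n).eval x * ((1 + x) / 2) ^ j)) = fun x => ∑ k ∈ Finset.range (n + 1),
      c k * ((1 - x) ^ β * (1 + x) ^ γ * (((1 - x) / 2) ^ k * ((1 + x) / 2) ^ j)) := by
    funext x
    rw [eval_jacobi, Finset.sum_mul, Finset.mul_sum]
    refine Finset.sum_congr rfl fun k _ => ?_
    simp only [hc]
    ring
  have hint : ∀ k ∈ Finset.range (n + 1), IntervalIntegrable (fun x : ℝ =>
      c k * ((1 - x) ^ β * (1 + x) ^ γ * (((1 - x) / 2) ^ k * ((1 + x) / 2) ^ j)))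
      MeasureTheory.volume (-1) 1 := fun k _ => (jacobi_moment hβ hγ k j).1.const_mul _
  rw [hfun]
  constructor
  · simpa only [Finset.sum_fn] using IntervalIntegrable.sum _ hint
  · intro hj
    rw [intervalIntegral.integral_finsetSum hint]
    simp only [intervalIntegral.integral_const_mul, (jacobi_moment hβ hγ _ j).2]
    have := sum_jacobi_moment hβ hγ hj
    calc _ = 2 * ((2 : ℝ) ^ β * 2 ^ γ) * ∑ k ∈ Finset.range (n + 1), c k *
          (Real.Gamma (γ + 1 + j) * Real.Gamma (β + 1 + k) /
            Real.Gamma (γ + 1 + j + (β + 1 + k))) := by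
          rw [Finset.mul_sum]
          exact Finset.sum_congr rfl fun k _ => by ring
      _ = 0 := by rw [hc, this, mul_zero]

theorem integral_jacobi_mul_of_lt {β γ : ℝ} (hβ : -1 < β) (hγ : -1 < γ) {n : ℕ}
    (Q : Polynomial ℝ) (hQ : Q.natDegree < n) :
    ∫ x in (-1 : ℝ)..1, (1 - x) ^ β * (1 + x) ^ γ * ((jacobi β γ n).eval x * Q.eval x) = 0 := by
  set T : Polynomial ℝ := Polynomial.taylor (-1) Q with hT
  have hTd : T.natDegree < n := by rwa [hT, Polynomial.natDegree_taylor]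
  have hQx : ∀ x : ℝ, Q.eval x = ∑ j ∈ Finset.range n, T.coeff j * 2 ^ j * ((1 + x) / 2) ^ j := by
    intro x
    have h1 : Q.eval x = T.eval (1 + x) := by
      rw [hT, Polynomial.taylor_eval]; congr 1; ring
    rw [h1, Polynomial.eval_eq_sum_range' hTd]
    refine Finset.sum_congr rfl fun j _ => ?_
    rw [div_pow, mul_assoc, mul_div_cancel₀ _ (by positivity)]
  have hfun : (fun x : ℝ => (1 - x) ^ β * (1 + x) ^ γ * ((jacobi β γ n).eval x * Q.eval x)) =
      fun x => ∑ j ∈ Finset.range n, T.coeff j * 2 ^ j * ((1 - x) ^ β * (1 + x) ^ γ *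
        ((jacobi β γ n).eval x * ((1 + x) / 2) ^ j)) := by
    funext x
    rw [hQx, Finset.mul_sum, Finset.mul_sum]
    exact Finset.sum_congr rfl fun j _ => by ring
  rw [hfun, intervalIntegral.integral_finsetSum
    fun j _ => (jacobi_orth_pow hβ hγ n j).1.const_mul _]
  refine Finset.sum_eq_zero fun j hj => ?_
  rw [intervalIntegral.integral_const_mul,
    (jacobi_orth_pow hβ hγ n j).2 (Finset.mem_range.1 hj), mul_zero]

/-- Orthogonality for the weight `(1 - x) ^ β * (1 + x) ^ γ` on `(-1, 1)`. -/
theorem integral_jacobi_mul_jacobi {β γ : ℝ} (hβ : -1 < β) (hγ : -1 < γ) {m n : ℕ}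
    (hmn : m ≠ n) :
    ∫ x in (-1 : ℝ)..1, (1 - x) ^ β * (1 + x) ^ γ *
      ((jacobi β γ m).eval x * (jacobi β γ n).eval x) = 0 := by
  rcases lt_or_gt_of_ne hmn with h | h
  · simp only [mul_comm ((jacobi β γ m).eval _)]
    exact integral_jacobi_mul_of_lt hβ hγ _ (by rwa [natDegree_jacobi hβ hγ])
  · exact integral_jacobi_mul_of_lt hβ hγ _ (by rwa [natDegree_jacobi hβ hγ])

/-! With `s = α / 2 < 1`, write the truncated integral at `x` as the tail integral of
`|t| ^ (-1 - 2 s)` times `(1 - x²) ^ s P(x)`, minus the integral of `(1 - y²) ^ s P(y)` against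
`|y - x| ^ (-1 - 2 s)` over the two sides of `x`. As a functional of the polynomial `P`, its limit
is the *finite part* `HasFinitePart`. The finite part is computed on all monomials, and the
resulting operator on polynomials is diagonalized.

*Monomials.* Integration by parts shows that total derivatives have finite part zero
(`hasFinitePart_ibpOp`); the boundary terms add up to a symmetric second difference. Applied to
powers of `y`, this is a recurrence that determines the finite part of `y ^ k` from those of `1`
and `y`. For these two, let `Q = 1 - 2 x y + x²`. The Möbius involution of `(-1, 1)` about `x`
sends the integrand of `(y - x) / Q` times a function of `(y - x)² / Q` to its negative, so that the
finite part vanishes (`hasFinitePart_oddKernel`); and for `(1 - x y) / Q` the substitution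
`ζ = (y - x)² / Q`, `1 - ζ = (1 - y²) / Q`, gives a Beta integral (`hasFinitePart_evenKernel`).
The functions `1` and `y` are combinations of these and of the total derivative that belongs
to `1 / Q`. The outcome is that the finite part of `y ^ k` is `Γ(1 - s) Γ(s)` times the
coefficient `kernelPoly s k` of `b ^ k` in `(1 - b²) ^ s (1 - b x) ^ (-1 - 2 s)`
(`hasFinitePart_pow`).

*Diagonalization.* The operator `y ^ k ↦ kernelPoly s k` preserves the degree filtration and
commutes with the differential operator `(1 - X²) p'' - 2 (s + 1) X p'`, whose eigenvalues on the
polynomials are distinct and whose eigenfunctions are the Jacobi polynomials. So these are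
eigenfunctions of both operators, and the eigenvalue is read off from the leading coefficient
(`kernelMap_jacobi`). The duplication formula turns the constants into `Γ(n + α + 1) / Γ(n + 1)`.

For `α = 2` the claim is the differential equation of the Jacobi polynomials. -/

/-! ### The Gegenbauer operator and its eigenfunctions -/

section Algebra

open Polynomial

/-- The Gegenbauer differential operator `(1 - X²) p'' - 2 (s + 1) X p'`. -/
noncomputable def gegenbauerOp (s : ℝ) : ℝ[X] →ₗ[ℝ] ℝ[X] :=
  LinearMap.mulLeft ℝ (1 - X ^ 2) ∘ₗ derivative ∘ₗ derivative -
    LinearMap.mulLeft ℝ (C (2 * (s + 1)) * X) ∘ₗ derivative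

theorem gegenbauerOp_apply (s : ℝ) (p : ℝ[X]) :
    gegenbauerOp s p = (1 - X ^ 2) * derivative (derivative p) -
      C (2 * (s + 1)) * X * derivative p := rfl

theorem coeff_gegenbauerOp (s : ℝ) (p : ℝ[X]) (m : ℕ) :
    (gegenbauerOp s p).coeff m =
      (m + 2) * (m + 1) * p.coeff (m + 2) - m * (m + 1 + 2 * s) * p.coeff m := by
  rw [gegenbauerOp_apply, sub_mul, one_mul, coeff_sub, coeff_sub, mul_assoc, coeff_C_mul,
    mul_comm (X ^ 2), mul_comm X]
  rcases m with _ | _ | m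
  · simp [coeff_derivative]
    ring
  · simp [coeff_derivative, coeff_mul_X_pow']
    ring
  · rw [coeff_mul_X, show m + 1 + 1 = m + 2 from rfl, coeff_mul_X_pow]
    simp only [coeff_derivative]
    push_cast
    ring

/-- The Jacobi polynomials with equal parameters `s` are eigenfunctions of the Gegenbauer
operator. -/
theorem gegenbauerOp_jacobi {s : ℝ} (hs : -1 < s) (n : ℕ) :
    gegenbauerOp s (jacobi s s n) = C (-(n * (n + 1 + 2 * s))) * jacobi s s n := by
  set U : ℝ[X] := C (1 / 2) * (1 - X) with hU
  have hdU : derivative U = -C (1 / 2) := by simp [hU]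
  have hX : (X : ℝ[X]) = 1 - C 2 * U := by
    rw [hU, ← mul_assoc, ← C_mul]; norm_num
  have hpow : ∀ k : ℕ, gegenbauerOp s (U ^ k) =
      C (k * (k + s)) * U ^ (k - 1) - C (k * (k + 1 + 2 * s)) * U ^ k := by
    have h2 : (2 : ℝ[X]) * C (1 / 2) = 1 := by
      rw [show (2 : ℝ[X]) = C 2 from rfl, ← C_mul]; norm_num
    have hC2 : (C 2 : ℝ[X]) = 2 := rfl
    rw [hC2] at hX
    have hd : ∀ k : ℕ, derivative (U ^ (k + 1)) = -(((k : ℝ[X]) + 1) * C (1 / 2) * U ^ k) := by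
      intro k
      rw [derivative_pow_succ, hdU, C_add, C_1, map_natCast]
      ring
    have hn : ∀ k : ℕ, derivative ((k : ℝ[X]) + 1) = 0 := by
      intro k
      rw [derivative_add, derivative_natCast, derivative_one, add_zero]
    intro k
    rw [gegenbauerOp_apply]
    rcases k with _ | _ | k
    · simp
    · rw [hd 0]
      simp only [pow_zero, mul_one, Nat.cast_zero, zero_add, derivative_neg,
        derivative_C, Nat.sub_self, pow_one, Nat.cast_one, map_mul, map_add,
        map_one, hC2, one_mul]
      rw [hX]
      linear_combination (C s + 1) * (1 - 2 * U) * h2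
    · rw [hd (k + 1)]
      simp only [derivative_neg, derivative_mul, derivative_C, hd, hn]
      rw [Nat.add_sub_cancel]
      conv_lhs => rw [hX]
      push_cast
      simp only [map_mul, map_add, map_natCast, map_one, hC2]
      have h4 : 4 * C (1 / 2 : ℝ) ^ 2 = 1 := by linear_combination (2 * C (1 / 2) + 1) * h2
      linear_combination ((k : ℝ[X]) + 2) * ((k : ℝ[X]) + 1) * U ^ (k + 1) * (1 - U) * h4 +
        ((k : ℝ[X]) + 2) * (C s + 1) * U ^ (k + 1) * (1 - 2 * U) * h2
  set c : ℕ → ℝ := fun k => (ascPochhammer ℝ k).eval (-(n : ℝ)) *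
        (ascPochhammer ℝ k).eval ((n : ℝ) + s + s + 1) /
        ((ascPochhammer ℝ k).eval (s + 1) * (k.factorial : ℝ)) with hc
  have hrec : ∀ k : ℕ, c (k + 1) * ((k + 1) * (k + 1 + s)) =
      c k * ((k - n) * (k + n + 1 + 2 * s)) := by
    intro k
    have h1 : (ascPochhammer ℝ k).eval (s + 1) ≠ 0 := (ascPochhammer_pos k _ (by linarith)).ne'
    have h2 : s + 1 + k ≠ 0 := by
      have : (0 : ℝ) ≤ k := k.cast_nonneg
      linarith
    have h3 : ((k.factorial : ℕ) : ℝ) ≠ 0 := by exact_mod_cast k.factorial_ne_zero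
    simp only [hc, ascPochhammer_succ_eval, Nat.factorial_succ]
    push_cast
    field_simp
    ring
  have hend : c (n + 1) = 0 := by
    simp [hc, ascPochhammer_succ_eval]
  have hj : jacobi s s n = ∑ k ∈ Finset.range (n + 1), C (c k) * U ^ k := rfl
  have hlin : ∀ k, gegenbauerOp s (C (c k) * U ^ k) = C (c k) * gegenbauerOp s (U ^ k) := by
    intro k
    rw [← smul_eq_C_mul, map_smul, smul_eq_C_mul]
  rw [hj, map_sum, Finset.mul_sum]
  simp only [hlin, hpow, mul_sub, Finset.sum_sub_distrib]
  rw [Finset.sum_range_succ']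
  have hshift : ∑ k ∈ Finset.range n, C (c (k + 1)) *
      (C (((k + 1 : ℕ) : ℝ) * (((k + 1 : ℕ) : ℝ) + s)) * U ^ (k + 1 - 1)) =
      ∑ k ∈ Finset.range (n + 1), C (c (k + 1)) *
      (C (((k + 1 : ℕ) : ℝ) * (((k + 1 : ℕ) : ℝ) + s)) * U ^ (k + 1 - 1)) := by
    rw [Finset.sum_range_succ, hend]; simp
  rw [hshift]
  simp only [Nat.cast_zero, zero_mul, C_0, mul_zero, add_zero]
  rw [← Finset.sum_sub_distrib]
  refine Finset.sum_congr rfl fun k _ => ?_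
  rw [Nat.add_sub_cancel, ← mul_assoc, ← mul_assoc, ← mul_assoc, ← C_mul, ← C_mul, ← C_mul,
    ← sub_mul, ← C_sub]
  congr 2
  have := hrec k
  push_cast
  rw [this]; ring

/-- The coefficient of `b ^ k * x ^ m` in the power series of
`(1 - b ^ 2) ^ s * (1 - b * x) ^ (-1 - 2 * s)`. -/
noncomputable def kernelCoeff (s : ℝ) (k m : ℕ) : ℝ :=
  if m ≤ k ∧ Even (k - m) then
    (ascPochhammer ℝ ((k - m) / 2)).eval (-s) / (((k - m) / 2).factorial : ℝ) *
      ((ascPochhammer ℝ m).eval (1 + 2 * s) / (m.factorial : ℝ))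
  else 0

theorem kernelCoeff_add (s : ℝ) (j m : ℕ) : kernelCoeff s (m + 2 * j) m =
    (ascPochhammer ℝ j).eval (-s) / (j.factorial : ℝ) *
      ((ascPochhammer ℝ m).eval (1 + 2 * s) / (m.factorial : ℝ)) := by
  rw [kernelCoeff, if_pos ⟨by omega, by simp⟩]
  simp

theorem kernelCoeff_eq_zero (s : ℝ) {k m : ℕ} (h : ∀ j, k ≠ m + 2 * j) :
    kernelCoeff s k m = 0 := by
  rw [kernelCoeff, if_neg]
  rintro ⟨h1, r, hr⟩
  exact h r (by omega)

theorem kernelCoeff_succ_right (s : ℝ) (j m : ℕ) :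
    (m + 1) * kernelCoeff s (m + 1 + 2 * j) (m + 1) =
      (1 + 2 * s + m) * kernelCoeff s (m + 2 * j) m := by
  have h3 : ((m.factorial : ℕ) : ℝ) ≠ 0 := by exact_mod_cast m.factorial_ne_zero
  have h4 : (m : ℝ) + 1 ≠ 0 := by positivity
  rw [kernelCoeff_add, kernelCoeff_add, ascPochhammer_succ_eval, Nat.factorial_succ]
  push_cast
  field_simp

theorem kernelCoeff_succ_left (s : ℝ) (j m : ℕ) :
    (j + 1) * kernelCoeff s (m + 2 * (j + 1)) m = (j - s) * kernelCoeff s (m + 2 * j) m := by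
  have h3 : ((j.factorial : ℕ) : ℝ) ≠ 0 := by exact_mod_cast j.factorial_ne_zero
  have h4 : (j : ℝ) + 1 ≠ 0 := by positivity
  rw [kernelCoeff_add, kernelCoeff_add, ascPochhammer_succ_eval, Nat.factorial_succ]
  push_cast
  field_simp
  ring

/-- The coefficient of `b ^ k` in the power series of
`(1 - b ^ 2) ^ s * (1 - b * X) ^ (-1 - 2 * s)`, a polynomial in `X`. -/
noncomputable def kernelPoly (s : ℝ) (k : ℕ) : ℝ[X] :=
  ∑ m ∈ Finset.range (k + 1), C (kernelCoeff s k m) * X ^ m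

theorem coeff_kernelPoly (s : ℝ) (k m : ℕ) : (kernelPoly s k).coeff m = kernelCoeff s k m := by
  simp only [kernelPoly, finsetSum_coeff, coeff_C_mul, coeff_X_pow, mul_ite, mul_one, mul_zero]
  rw [Finset.sum_ite_eq (Finset.range (k + 1)) m]
  split_ifs with h
  · rfl
  · rw [kernelCoeff_eq_zero]
    intro j hj
    simp at h
    omega

/-! ### The operator given by the generating function -/

/-- The operator on polynomials sending `X ^ k` to `kernelPoly s k`. -/
noncomputable def kernelMap (s : ℝ) : ℝ[X] →ₗ[ℝ] ℝ[X] :=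
  Polynomial.lsum fun k => LinearMap.toSpanSingleton ℝ ℝ[X] (kernelPoly s k)

theorem kernelMap_monomial (s : ℝ) (k : ℕ) (a : ℝ) :
    kernelMap s (monomial k a) = C a * kernelPoly s k := by
  rw [kernelMap, lsum_apply, sum_monomial_index _ _ (by simp), LinearMap.toSpanSingleton_apply,
    smul_eq_C_mul]

theorem gegenbauerOp_monomial (s : ℝ) (k : ℕ) (a : ℝ) :
    gegenbauerOp s (monomial k a) =
      monomial (k - 2) (k * (k - 1) * a) - monomial k (k * (k + 1 + 2 * s) * a) := by
  ext m
  rw [coeff_gegenbauerOp]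
  simp only [coeff_sub, coeff_monomial]
  rcases k with _ | _ | k
  · rcases m with _ | m <;> simp
  · rcases m with _ | m <;> simp
    rcases m with _ | m <;> simp
  · have e : k + 1 + 1 = m + 2 ↔ k = m := by omega
    simp only [e, show k + 1 + 1 - 2 = k by omega]
    by_cases h1 : k = m
    · subst h1
      rw [if_pos rfl, if_pos rfl, if_neg (by omega), if_neg (by omega)]
      push_cast
      ring
    · by_cases h2 : k + 1 + 1 = m
      · subst h2
        rw [if_neg h1, if_pos rfl, if_neg h1, if_pos rfl]
        push_cast
        ring
      · simp [h1, h2]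

/-- The Gegenbauer operator has the same matrix on the family `kernelPoly s k` as on the powers
`X ^ k`, for which see `gegenbauerOp_monomial`. -/
theorem gegenbauerOp_kernelPoly (s : ℝ) (k : ℕ) :
    gegenbauerOp s (kernelPoly s k) =
      C (k * (k - 1) : ℝ) * kernelPoly s (k - 2) - C (k * (k + 1 + 2 * s)) * kernelPoly s k := by
  ext m
  rw [coeff_gegenbauerOp, coeff_sub, coeff_C_mul, coeff_C_mul]
  simp only [coeff_kernelPoly]
  by_cases h : ∃ j, k = m + 2 * j
  · obtain ⟨j, rfl⟩ := h
    rcases j with _ | j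
    · rw [kernelCoeff_eq_zero s (k := m + 2 * 0) (m := m + 2) (by omega)]
      have : (m * (m - 1) : ℝ) * kernelCoeff s (m + 2 * 0 - 2) m = 0 := by
        rcases m with _ | _ | m
        · simp
        · simp
        · rw [kernelCoeff_eq_zero s (by omega), mul_zero]
      simp only [mul_zero, add_zero] at this ⊢
      rw [this]
    · have h1 := kernelCoeff_succ_right s j m
      have h2 := kernelCoeff_succ_right s j (m + 1)
      have h3 := kernelCoeff_succ_left s j m
      rw [show m + 2 * (j + 1) - 2 = m + 2 * j by omega]
      rw [show m + 1 + 1 + 2 * j = m + 2 * (j + 1) by ring, show m + 1 + 1 = m + 2 from rfl] at h2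
      push_cast at *
      linear_combination ((m : ℝ) + 1) * h2 + (2 + 2 * s + m) * h1 +
        2 * (2 * m + 2 * j + 3 + 2 * s) * h3
  · push Not at h
    rw [kernelCoeff_eq_zero s h, kernelCoeff_eq_zero s (k := k) (m := m + 2)
      (fun j hj => h (j + 1) (by omega))]
    rcases k with _ | _ | k
    · simp
    · simp
    · rw [kernelCoeff_eq_zero s (fun j hj => h (j + 1) (by omega))]
      simp

theorem gegenbauerOp_kernelMap (s : ℝ) (p : ℝ[X]) :
    gegenbauerOp s (kernelMap s p) = kernelMap s (gegenbauerOp s p) := by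
  induction p using Polynomial.induction_on' with
  | add p q hp hq => simp only [map_add, hp, hq]
  | monomial k a =>
    rw [gegenbauerOp_monomial, map_sub, kernelMap_monomial, kernelMap_monomial,
      kernelMap_monomial, ← smul_eq_C_mul, map_smul, gegenbauerOp_kernelPoly, smul_eq_C_mul]
    simp only [C_mul]
    ring

theorem coeff_kernelMap (s : ℝ) (p : ℝ[X]) (m : ℕ) :
    (kernelMap s p).coeff m = p.sum fun k a => a * kernelCoeff s k m := by
  induction p using Polynomial.induction_on' with
  | add p q hp hq =>
    rw [map_add, coeff_add, hp, hq, sum_add_index _ _ _ (by simp) (by intros; ring)]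
  | monomial k a =>
    rw [kernelMap_monomial, coeff_C_mul, coeff_kernelPoly, sum_monomial_index _ _ (by simp)]

/-- There is no eigenpolynomial of degree less than `n` for the `n`-th eigenvalue: the leading
coefficient determines the eigenvalue, and the eigenvalues are distinct. -/
theorem eq_zero_of_gegenbauerOp_eq {s : ℝ} (hs : -1 < s) {n : ℕ} {p : ℝ[X]}
    (hp : gegenbauerOp s p = C (-(n * (n + 1 + 2 * s))) * p) (hdeg : ∀ m, n ≤ m → p.coeff m = 0) :
    p = 0 := by
  by_contra h0
  set m := p.natDegree with hm
  have hlead : p.coeff m ≠ 0 := by rwa [hm, coeff_natDegree, leadingCoeff_ne_zero]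
  have hmn : m < n := by
    by_contra hc
    exact hlead (hdeg m (by omega))
  have h1 := congrArg (fun q => coeff q m) hp
  simp only [coeff_gegenbauerOp, coeff_C_mul] at h1
  rw [coeff_eq_zero_of_natDegree_lt (show p.natDegree < m + 2 by omega)] at h1
  have h2 : ((n : ℝ) - m) * (n + m + 1 + 2 * s) * p.coeff m = 0 := by linear_combination h1
  have h3 : (0 : ℝ) < n - m := by
    have : (m : ℝ) < n := by exact_mod_cast hmn
    linarith
  have h4 : (0 : ℝ) < n + m + 1 + 2 * s := by
    have : (1 : ℝ) ≤ n := by exact_mod_cast (by omega : 1 ≤ n)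
    have : (0 : ℝ) ≤ m := m.cast_nonneg
    linarith
  exact (mul_ne_zero (mul_pos h3 h4).ne' hlead) h2

/-- The Jacobi polynomials are eigenfunctions of `kernelMap s`; after subtracting the multiple with
the right leading coefficient, the difference has degree less than `n`. -/
theorem kernelMap_jacobi {s : ℝ} (hs : -1 < s) (n : ℕ) :
    kernelMap s (jacobi s s n) =
      C ((ascPochhammer ℝ n).eval (1 + 2 * s) / (n.factorial : ℝ)) * jacobi s s n := by
  rw [← sub_eq_zero]
  apply eq_zero_of_gegenbauerOp_eq hs (n := n)
  · rw [map_sub, gegenbauerOp_kernelMap, gegenbauerOp_jacobi hs, ← smul_eq_C_mul,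
      ← smul_eq_C_mul, map_smul, map_smul, gegenbauerOp_jacobi hs]
    simp only [smul_eq_C_mul]
    ring
  · have hdeg := natDegree_jacobi hs hs n
    intro m hm
    rw [coeff_sub, coeff_C_mul, coeff_kernelMap, sum_over_range' _ (by simp) (n + 1) (by omega)]
    rw [Finset.sum_range_succ, Finset.sum_eq_zero, zero_add]
    · rcases hm.eq_or_lt with rfl | hlt
      · have := kernelCoeff_add s 0 n
        simp only [mul_zero, add_zero, Nat.factorial_zero, Nat.cast_one, div_one,
          ascPochhammer_zero, eval_one, one_mul] at this
        rw [this]; ring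
      · rw [kernelCoeff_eq_zero s (k := n) (m := m) (by omega),
          coeff_eq_zero_of_natDegree_lt (p := jacobi s s n) (hdeg.trans_lt hlt), mul_zero,
          mul_zero, sub_zero]
    · intro k hk
      rw [kernelCoeff_eq_zero s (by have := Finset.mem_range.1 hk; omega), mul_zero]

theorem kernelPoly_zero (s : ℝ) : kernelPoly s 0 = 1 := by
  have := kernelCoeff_add s 0 0
  simp only [mul_zero, add_zero] at this
  simp [kernelPoly, this]

theorem kernelPoly_one (s : ℝ) : kernelPoly s 1 = C (1 + 2 * s) * X := by
  have := kernelCoeff_add s 0 1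
  simp only [mul_zero, add_zero] at this
  simp [kernelPoly, Finset.sum_range_succ, this, kernelCoeff_eq_zero s (k := 1) (m := 0) (by omega)]

/-- The differential equation in `b` of the generating function
`(1 - b²) ^ s (1 - b x) ^ (-1 - 2 s)`, written for its coefficients. For `k = 0` the truncated index `k - 1` has the factor `0`. -/
theorem kernelPoly_recurrence (s : ℝ) (k : ℕ) :
    C (k + 2 : ℝ) * kernelPoly s (k + 2) = C (k + 2 + 2 * s) * X * kernelPoly s (k + 1) +
      C (k - 2 * s) * kernelPoly s k - C (k : ℝ) * X * kernelPoly s (k - 1) := by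
  ext m
  simp only [mul_assoc, coeff_sub, coeff_add, coeff_C_mul, coeff_kernelPoly]
  rcases m with _ | m
  · simp only [coeff_X_mul_zero, mul_zero, zero_add, sub_zero]
    by_cases h : ∃ j, k = 2 * j
    · obtain ⟨j, rfl⟩ := h
      have h3 := kernelCoeff_succ_left s j 0
      simp only [zero_add] at h3
      rw [show 2 * (j + 1) = 2 * j + 2 by ring] at h3
      push_cast
      linear_combination 2 * h3
    · push Not at h
      rw [kernelCoeff_eq_zero s (m := 0) (fun j hj => h (j - 1) (by omega)),
        kernelCoeff_eq_zero s (m := 0) (fun j hj => h j (by omega))]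
      simp
  · simp only [coeff_X_mul, coeff_kernelPoly]
    by_cases h : ∃ j, k + 1 = m + 2 * j
    · obtain ⟨j, hj⟩ := h
      rcases j with _ | j
      · obtain rfl : m = k + 1 := by omega
        have h1 := kernelCoeff_succ_right s 0 (k + 1)
        rw [kernelCoeff_eq_zero s (k := k) (by omega),
          kernelCoeff_eq_zero s (k := k - 1) (by omega)]
        simp only [mul_zero, add_zero] at h1
        push_cast at h1 ⊢
        linear_combination h1
      · obtain rfl : k = m + 1 + 2 * j := by omega
        have h1 := kernelCoeff_succ_right s (j + 1) m
        have h2 := kernelCoeff_succ_right s j m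
        have h3 := kernelCoeff_succ_left s j (m + 1)
        have h4 := kernelCoeff_succ_left s j m
        rw [show m + 1 + 2 * j - 1 = m + 2 * j by omega,
          show m + 1 + 2 * j + 1 = m + 2 * (j + 1) by ring,
          show m + 1 + 2 * j + 2 = m + 1 + 2 * (j + 1) by ring]
        push_cast at *
        linear_combination h1 - h2 + 2 * h3 - 2 * h4
    · push Not at h
      rw [kernelCoeff_eq_zero s (k := k + 2) (m := m + 1) (fun j hj => h j (by omega)),
        kernelCoeff_eq_zero s (k := k + 1) (m := m) (fun j hj => h j (by omega)),
        kernelCoeff_eq_zero s (k := k) (m := m + 1) (fun j hj => h (j + 1) (by omega))]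
      rcases k with _ | k
      · simp
      · rw [kernelCoeff_eq_zero s (k := k + 1 - 1) (m := m) (fun j hj => h (j + 1) (by omega))]
        simp

end Algebra

section FinitePart

open Filter Topology Set

/-! ### Second differences, finite parts and integration by parts -/

theorem isBigO_second_difference {ψ : ℝ → ℝ} {x : ℝ} (hψ : ContDiffAt ℝ 2 ψ x) :
    (fun h : ℝ => ψ (x + h) + ψ (x - h) - 2 * ψ x) =O[𝓝 0] fun h => h ^ 2 := by
  obtain ⟨u, hu, hxu, hψu⟩ := hψ.contDiffOn' (m := 2) le_rfl (by simp)
  obtain ⟨r, hr, hru⟩ := Metric.isOpen_iff.1 hu x hxu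
  have hx : x ∈ Metric.ball x r := Metric.mem_ball_self hr
  have hball : Metric.ball x r ∈ 𝓝 x := Metric.ball_mem_nhds x hr
  have ht := taylor_isLittleO (n := 2) (convex_ball x r) hx
    (hψu.mono fun y hy => by simpa using hru hy)
  rw [nhdsWithin_eq_nhds.2 hball] at ht
  set a := derivWithin ψ (Metric.ball x r) x
  set b := iteratedDerivWithin 2 ψ (Metric.ball x r) x
  have hT : ∀ y, taylorWithinEval ψ 2 (Metric.ball x r) x y =
      ψ x + a * (y - x) + b / 2 * (y - x) ^ 2 := by
    intro y
    simp [taylorWithinEval_succ, taylor_within_zero_eval, a, b, iteratedDerivWithin_one]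
    ring
  have hp : Tendsto (fun h : ℝ => x + h) (𝓝 0) (𝓝 x) := by
    have : Continuous fun h : ℝ => x + h := by fun_prop
    simpa using this.tendsto 0
  have hm : Tendsto (fun h : ℝ => x - h) (𝓝 0) (𝓝 x) := by
    have : Continuous fun h : ℝ => x - h := by fun_prop
    simpa using this.tendsto 0
  have h1 := (ht.comp_tendsto hp).isBigO
  have h2 := (ht.comp_tendsto hm).isBigO
  simp only [Function.comp_def, hT, add_sub_cancel_left, sub_sub_cancel_left, neg_sq] at h1 h2
  have h3 : (fun h : ℝ => b * h ^ 2) =O[𝓝 0] fun h => h ^ 2 :=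
    (Asymptotics.isBigO_refl _ _).const_mul_left b
  refine ((h1.add h2).add h3).congr_left fun h => ?_
  ring

theorem tendsto_rpow_mul_of_isBigO_sq {s : ℝ} (hs : s < 1) {f : ℝ → ℝ}
    (hf : f =O[𝓝[>] 0] fun h => h ^ 2) :
    Tendsto (fun ε : ℝ => ε ^ (-2 * s) * f ε) (𝓝[>] 0) (𝓝 0) := by
  have h1 : (fun ε : ℝ => ε ^ (-2 * s) * f ε) =O[𝓝[>] 0] fun ε => ε ^ (-2 * s) * ε ^ 2 :=
    (Asymptotics.isBigO_refl _ _).mul hf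
  refine h1.trans_tendsto ?_
  have h2 : Tendsto (fun ε : ℝ => ε ^ (2 - 2 * s)) (𝓝[>] 0) (𝓝 0) := by
    have := (Real.continuousAt_rpow_const 0 (2 - 2 * s) (Or.inr (by linarith))).tendsto
    rw [Real.zero_rpow (by linarith)] at this
    exact this.mono_left nhdsWithin_le_nhds
  refine h2.congr' ?_
  filter_upwards [self_mem_nhdsWithin] with ε hε
  rw [← Real.rpow_natCast, ← Real.rpow_add hε]
  congr 1
  push_cast
  ring

theorem tendsto_rpow_mul_second_difference {s : ℝ} (hs : s < 1) {ψ : ℝ → ℝ} {x : ℝ}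
    (hψ : ContDiffAt ℝ 2 ψ x) :
    Tendsto (fun ε : ℝ => ε ^ (-2 * s) * (ψ (x + ε) + ψ (x - ε) - 2 * ψ x)) (𝓝[>] 0) (𝓝 0) :=
  tendsto_rpow_mul_of_isBigO_sq hs ((isBigO_second_difference hψ).mono nhdsWithin_le_nhds)

/-- The integral over `(x + ε, 1)` of the weight `(1 - y²) ^ s` times `p`, against the kernel
`|y - x| ^ (-1 - 2 s)`. -/
noncomputable def sideIntegral (s x : ℝ) (p : ℝ → ℝ) (ε : ℝ) : ℝ :=
  ∫ y in (x + ε)..1, (1 - y ^ 2) ^ s * p y * (y - x) ^ (-1 - 2 * s)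

/-- The truncated finite part at `x` of `-∫ (1 - y²) ^ s p(y) |y - x| ^ (-1 - 2 s) dy` over
`(-1, 1)`: the divergent term is compensated by the tail integral of `|t| ^ (-1 - 2 s)`.
The part of the integral to the left of `x` is reflected to the right of `-x`. -/
noncomputable def truncFinitePart (s x : ℝ) (p : ℝ → ℝ) (ε : ℝ) : ℝ :=
  (1 - x ^ 2) ^ s * p x * ε ^ (-2 * s) / s - sideIntegral s x p ε -
    sideIntegral s (-x) (fun y => p (-y)) ε

/-- The finite part at `x` of `-∫ (1 - y²) ^ s p(y) |y - x| ^ (-1 - 2 s) dy` exists and is `L`. -/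
def HasFinitePart (s x : ℝ) (p : ℝ → ℝ) (L : ℝ) : Prop :=
  Tendsto (truncFinitePart s x p) (𝓝[>] 0) (𝓝 L)

theorem continuousOn_sideIntegrand {s x ε : ℝ} (hs : 0 < s) (hx : -1 < x) (hε : 0 < ε)
    {p : ℝ → ℝ} (hp : ContinuousOn p (Icc (-1) 1)) :
    ContinuousOn (fun y => (1 - y ^ 2) ^ s * p y * (y - x) ^ (-1 - 2 * s)) (Icc (x + ε) 1) := by
  refine ContinuousOn.mul (ContinuousOn.mul ?_ (hp.mono (Icc_subset_Icc (by linarith) le_rfl))) ?_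
  · exact ContinuousOn.rpow_const (by fun_prop) fun y _ => Or.inr hs.le
  · exact ContinuousOn.rpow_const (by fun_prop) fun y hy => Or.inl (by linarith [hy.1])

theorem intervalIntegrable_sideIntegrand {s x ε : ℝ} (hs : 0 < s) (hx : -1 < x) (hε : 0 < ε)
    (hε1 : x + ε ≤ 1) {p : ℝ → ℝ} (hp : ContinuousOn p (Icc (-1) 1)) :
    IntervalIntegrable (fun y => (1 - y ^ 2) ^ s * p y * (y - x) ^ (-1 - 2 * s))
      MeasureTheory.volume (x + ε) 1 :=
  (uIcc_of_le hε1 ▸ continuousOn_sideIntegrand hs hx hε hp).intervalIntegrable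

theorem sideIntegral_add {s x ε : ℝ} (hs : 0 < s) (hx : -1 < x) (hε : 0 < ε)
    (hε1 : x + ε ≤ 1) {p q : ℝ → ℝ} (hp : ContinuousOn p (Icc (-1) 1))
    (hq : ContinuousOn q (Icc (-1) 1)) :
    sideIntegral s x (fun y => p y + q y) ε = sideIntegral s x p ε + sideIntegral s x q ε := by
  rw [sideIntegral, sideIntegral, sideIntegral, ← intervalIntegral.integral_add
    (intervalIntegrable_sideIntegrand hs hx hε hε1 hp)
    (intervalIntegrable_sideIntegrand hs hx hε hε1 hq)]
  exact intervalIntegral.integral_congr fun y _ => by ring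

theorem sideIntegral_const_mul (s x ε c : ℝ) (p : ℝ → ℝ) :
    sideIntegral s x (fun y => c * p y) ε = c * sideIntegral s x p ε := by
  rw [sideIntegral, sideIntegral, ← intervalIntegral.integral_const_mul]
  exact intervalIntegral.integral_congr fun y _ => by ring

theorem sideIntegral_congr {s x ε : ℝ} (hx : -1 < x) (hε : 0 < ε) (hε1 : x + ε ≤ 1)
    {p q : ℝ → ℝ} (h : EqOn p q (Icc (-1) 1)) : sideIntegral s x p ε = sideIntegral s x q ε := by
  refine intervalIntegral.integral_congr fun y hy => ?_
  rw [uIcc_of_le hε1] at hy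
  simp only [h ⟨by linarith [hy.1], hy.2⟩]

theorem continuousOn_comp_neg {p : ℝ → ℝ} (hp : ContinuousOn p (Icc (-1) 1)) :
    ContinuousOn (fun y => p (-y)) (Icc (-1) 1) :=
  hp.comp continuousOn_neg fun y hy => ⟨by linarith [hy.2], by linarith [hy.1]⟩

theorem eventually_small {x : ℝ} (hx : x ∈ Ioo (-1 : ℝ) 1) :
    ∀ᶠ ε in 𝓝[>] (0 : ℝ), 0 < ε ∧ x + ε < 1 ∧ -x + ε < 1 := by
  have h : (0 : ℝ) < min (1 - x) (1 + x) := lt_min (by linarith [hx.2]) (by linarith [hx.1])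
  filter_upwards [Ioo_mem_nhdsGT h] with ε hε
  have h1 := hε.2.trans_le (min_le_left _ _)
  have h2 := hε.2.trans_le (min_le_right _ _)
  exact ⟨hε.1, by linarith, by linarith⟩

theorem HasFinitePart.congr {s x L : ℝ} (hx : x ∈ Ioo (-1 : ℝ) 1) {p q : ℝ → ℝ}
    (hp : HasFinitePart s x p L) (h : EqOn p q (Icc (-1) 1)) : HasFinitePart s x q L := by
  refine Tendsto.congr' ?_ hp
  filter_upwards [eventually_small hx] with ε ⟨h0, h1, h2⟩
  rw [truncFinitePart, truncFinitePart, h ⟨hx.1.le, hx.2.le⟩, sideIntegral_congr hx.1 h0 h1.le h,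
    sideIntegral_congr (x := -x) (q := fun y => q (-y)) (by linarith [hx.2]) h0 h2.le]
  exact fun y hy => h ⟨by linarith [hy.2], by linarith [hy.1]⟩

theorem HasFinitePart.add {s x L M : ℝ} (hs : 0 < s) (hx : x ∈ Ioo (-1 : ℝ) 1) {p q : ℝ → ℝ}
    (hp : HasFinitePart s x p L) (hq : HasFinitePart s x q M) (hpc : ContinuousOn p (Icc (-1) 1))
    (hqc : ContinuousOn q (Icc (-1) 1)) : HasFinitePart s x (fun y => p y + q y) (L + M) := by
  refine Tendsto.congr' ?_ (Tendsto.add hp hq)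
  filter_upwards [eventually_small hx] with ε ⟨h0, h1, h2⟩
  rw [truncFinitePart, truncFinitePart, truncFinitePart, sideIntegral_add hs hx.1 h0 h1.le hpc hqc,
    sideIntegral_add (p := fun y => p (-y)) (q := fun y => q (-y)) hs (by linarith [hx.2]) h0 h2.le
      (continuousOn_comp_neg hpc) (continuousOn_comp_neg hqc)]
  ring

theorem HasFinitePart.const_mul {s x L : ℝ} {p : ℝ → ℝ} (hp : HasFinitePart s x p L) (c : ℝ) :
    HasFinitePart s x (fun y => c * p y) (c * L) := by
  refine (Tendsto.const_mul c hp).congr fun ε => ?_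
  rw [truncFinitePart, truncFinitePart, sideIntegral_const_mul,
    sideIntegral_const_mul (p := fun y => p (-y))]
  ring

/-- For the weight `(1 - y²) ^ s`, the function `ibpOp s x q q'` times the kernel
`|y - x| ^ (-1 - 2 s)` is the derivative of `-(1 - y²) ^ (s + 1) q(y) (y - x) |y - x| ^ (-1 - 2 s)`;
here `q'` stands for the derivative of `q`. -/
def ibpOp (s x : ℝ) (q q' : ℝ → ℝ) (y : ℝ) : ℝ :=
  2 * (s + 1) * y * (y - x) * q y - (1 - y ^ 2) * (y - x) * q' y + 2 * s * (1 - y ^ 2) * q y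

theorem continuousOn_ibpOp (s x : ℝ) {q q' : ℝ → ℝ} {S : Set ℝ} (hq : ContinuousOn q S)
    (hq' : ContinuousOn q' S) : ContinuousOn (ibpOp s x q q') S := by
  unfold ibpOp
  fun_prop

theorem sideIntegral_ibpOp {s x ε : ℝ} (hs : 0 < s) (hx : -1 < x) (hε : 0 < ε) (hε1 : x + ε < 1)
    {q q' : ℝ → ℝ} (hq : ∀ y ∈ Icc (-1 : ℝ) 1, HasDerivAt q (q' y) y)
    (hq' : ContinuousOn q' (Icc (-1) 1)) :
    sideIntegral s x (ibpOp s x q q') ε =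
      (1 - (x + ε) ^ 2) ^ (s + 1) * q (x + ε) * ε ^ (-2 * s) := by
  have hqc : ContinuousOn q (Icc (-1) 1) := fun y hy => (hq y hy).continuousAt.continuousWithinAt
  have hsub : Icc (x + ε) 1 ⊆ Icc (-1 : ℝ) 1 := Icc_subset_Icc (by linarith) le_rfl
  rw [sideIntegral, intervalIntegral.integral_eq_sub_of_hasDerivAt_of_le (f := fun y =>
    -((1 - y ^ 2) ^ (s + 1) * q y * (y - x) ^ (-2 * s))) hε1.le]
  · simp only [one_pow, sub_self, Real.zero_rpow (by linarith : s + 1 ≠ 0), add_sub_cancel_left]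
    ring
  · refine ((ContinuousOn.mul ?_ (hqc.mono hsub)).mul ?_).neg
    · exact ContinuousOn.rpow_const (by fun_prop) fun y _ => Or.inr (by linarith)
    · exact ContinuousOn.rpow_const (by fun_prop) fun y hy => Or.inl (by linarith [hy.1])
  · intro y hy
    have hyx : 0 < y - x := by linarith [hy.1]
    have h1y : 0 < 1 - y ^ 2 := by nlinarith [hy.1, hy.2]
    have d1 : HasDerivAt (fun y : ℝ => (1 - y ^ 2) ^ (s + 1))
        (-(2 * y) * (s + 1) * (1 - y ^ 2) ^ s) y := by
      have h0 : HasDerivAt (fun y : ℝ => 1 - y ^ 2) (-(2 * y)) y := by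
        simpa using (hasDerivAt_pow 2 y).const_sub 1
      convert! h0.rpow_const (p := s + 1) (Or.inl h1y.ne') using 1
      rw [add_sub_cancel_right]
    have d2 : HasDerivAt (fun y : ℝ => (y - x) ^ (-2 * s)) (-2 * s * (y - x) ^ (-1 - 2 * s)) y := by
      convert! ((hasDerivAt_id y).sub_const x).rpow_const (p := -2 * s) (Or.inl hyx.ne') using 1
      rw [show -2 * s - 1 = -1 - 2 * s by ring]
      simp
    convert! ((d1.mul (hq y (hsub ⟨hy.1.le, hy.2.le⟩))).mul d2).neg using 1
    simp only [Pi.mul_apply]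
    rw [Real.rpow_add_one h1y.ne', show -2 * s = -1 - 2 * s + 1 by ring,
      Real.rpow_add_one hyx.ne', ibpOp]
    ring
  · exact intervalIntegrable_sideIntegrand hs hx hε hε1.le (continuousOn_ibpOp s x hqc hq')

/-- Integration by parts: total derivatives have vanishing finite part. -/
theorem hasFinitePart_ibpOp {s x : ℝ} (hs : 0 < s) (hs1 : s < 1) (hx : x ∈ Ioo (-1 : ℝ) 1)
    {q q' : ℝ → ℝ} (hq : ∀ y ∈ Icc (-1 : ℝ) 1, HasDerivAt q (q' y) y)
    (hq' : ContinuousOn q' (Icc (-1) 1)) (hq2 : ContDiffAt ℝ 2 q x) :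
    HasFinitePart s x (ibpOp s x q q') 0 := by
  have h1x : 0 < 1 - x ^ 2 := by nlinarith [hx.1, hx.2]
  have hψ : ContDiffAt ℝ 2 (fun y : ℝ => (1 - y ^ 2) ^ (s + 1) * q y) x :=
    (ContDiffAt.rpow_const_of_ne (f := fun y : ℝ => 1 - y ^ 2) (by fun_prop) h1x.ne').mul hq2
  have h := (tendsto_rpow_mul_second_difference hs1 hψ).neg
  rw [neg_zero] at h
  refine h.congr' ?_
  filter_upwards [eventually_small hx] with ε ⟨h0, h1, h2⟩
  have hneg : (fun y => ibpOp s x q q' (-y)) =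
      ibpOp s (-x) (fun y => q (-y)) fun y => -q' (-y) := by
    funext y
    simp only [ibpOp]
    ring
  have hqn : ∀ y ∈ Icc (-1 : ℝ) 1, HasDerivAt (fun y => q (-y)) (-q' (-y)) y := by
    intro y hy
    have := (hq (-y) ⟨by linarith [hy.2], by linarith [hy.1]⟩).comp y (hasDerivAt_neg y)
    simpa [Function.comp_def] using this
  rw [truncFinitePart, sideIntegral_ibpOp hs hx.1 h0 h1 hq hq', hneg,
    sideIntegral_ibpOp hs (by linarith [hx.2]) h0 h2 hqn (continuousOn_comp_neg hq').neg]
  simp only [ibpOp, sub_self, Real.rpow_add_one h1x.ne']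
  rw [show (-x + ε) ^ 2 = (x - ε) ^ 2 by ring, show -(-x + ε) = x - ε by ring]
  field_simp
  ring

/-! ### The Möbius involution -/

/-- The quadratic expression `(1 - y²) + (y - x)²`, linear in `y`. -/
def quadKernel (x y : ℝ) : ℝ := 1 - 2 * x * y + x ^ 2

theorem quadKernel_pos {x y : ℝ} (hx : x ∈ Ioo (-1 : ℝ) 1) (hy : y ∈ Icc (-1 : ℝ) 1) :
    0 < quadKernel x y := by
  have e : quadKernel x y = (1 + y) / 2 * (1 - x) ^ 2 + (1 - y) / 2 * (1 + x) ^ 2 := by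
    rw [quadKernel]; ring
  have h1 : 0 < (1 - x) ^ 2 := pow_pos (by linarith [hx.2]) 2
  have h2 : 0 < (1 + x) ^ 2 := pow_pos (by linarith [hx.1]) 2
  rw [e]
  rcases lt_or_ge y 0 with h | h
  · exact add_pos_of_nonneg_of_pos (mul_nonneg (by linarith [hy.1]) h1.le)
      (mul_pos (by linarith) h2)
  · exact add_pos_of_pos_of_nonneg (mul_pos (by linarith) h1)
      (mul_nonneg (by linarith [hy.2]) h2.le)

theorem quadKernel_neg (x y : ℝ) : quadKernel x (-y) = quadKernel (-x) y := by
  simp only [quadKernel]; ring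

theorem hasDerivAt_quadKernel (x y : ℝ) : HasDerivAt (quadKernel x) (-2 * x) y := by
  have := (((hasDerivAt_id y).const_mul (2 * x)).const_sub 1).add_const (x ^ 2)
  convert! this using 1
  ring

theorem continuous_quadKernel (x : ℝ) : Continuous (quadKernel x) := by
  unfold quadKernel
  fun_prop

/-- Functions of the form `(y - x) / Q * (c₀ + c₁ (y - x)² / Q)` with `Q = quadKernel x y`;
under the Möbius involution about `x`, their product with the weight and the kernel is odd. -/
noncomputable def oddKernel (x c₀ c₁ y : ℝ) : ℝ :=
  (y - x) / quadKernel x y * (c₀ + c₁ * ((y - x) ^ 2 / quadKernel x y))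

theorem continuousOn_oddKernel {x : ℝ} (hx : x ∈ Ioo (-1 : ℝ) 1) (c₀ c₁ : ℝ) :
    ContinuousOn (oddKernel x c₀ c₁) (Icc (-1) 1) := by
  have hQ := (continuous_quadKernel x).continuousOn (s := Icc (-1) 1)
  have h0 : ∀ y ∈ Icc (-1 : ℝ) 1, quadKernel x y ≠ 0 := fun y hy => (quadKernel_pos hx hy).ne'
  unfold oddKernel
  fun_prop (disch := assumption)

/-- The Möbius involution of `(-1, 1)` that fixes `x` and exchanges its two sides multiplies the
integrand built from `oddKernel` by `-1`, so it carries the integral over one side of `x` to minus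
the integral over the other side, with a different truncation. -/
theorem sideIntegral_neg_oddKernel {s x ε : ℝ} (hx : x ∈ Ioo (-1 : ℝ) 1)
    (hε : 0 < ε) (hε1 : -x + ε < 1) (c₀ c₁ : ℝ) :
    sideIntegral s (-x) (fun y => oddKernel x c₀ c₁ (-y)) ε =
      -sideIntegral s x (oddKernel x c₀ c₁)
        ((1 - x ^ 2) * ε / (1 - x ^ 2 + 2 * x * ε)) := by
  have hx' : -x ∈ Ioo (-1 : ℝ) 1 := ⟨by linarith [hx.2], by linarith [hx.1]⟩
  have hM : 0 < 1 - x ^ 2 := by nlinarith [hx.1, hx.2]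
  set M := 1 - x ^ 2 with hMdef
  set q : ℝ → ℝ := quadKernel (-x) with hq
  have hqpos : ∀ y ∈ Icc (-x + ε) 1, 0 < q y := fun y hy =>
    quadKernel_pos hx' ⟨by linarith [hy.1, hx.2], hy.2⟩
  have hqe : ∀ y, q y = 1 + 2 * x * y + x ^ 2 := fun y => by rw [hq, quadKernel]; ring
  set τ : ℝ → ℝ := fun y => (2 * x + (1 + x ^ 2) * y) / q y with hτ
  have hcv := intervalIntegral.integral_comp_mul_deriv_of_deriv_nonneg (a := -x + ε) (b := 1)
    (f := τ) (f' := fun y => M ^ 2 / q y ^ 2)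
    (g := fun y => (1 - y ^ 2) ^ s * oddKernel x c₀ c₁ y * (y - x) ^ (-1 - 2 * s)) ?_ ?_ ?_
  · have hτ1 : τ 1 = 1 := by
      have h := hqpos 1 ⟨hε1.le, le_rfl⟩
      simp only [hτ]
      rw [div_eq_one_iff_eq h.ne', hqe]
      ring
    have hτε : τ (-x + ε) = x + M * ε / (M + 2 * x * ε) := by
      have h := hqpos (-x + ε) ⟨le_rfl, hε1.le⟩
      rw [hqe] at h
      have h' : 0 < M + 2 * x * ε := by rw [hMdef]; linarith
      simp only [hτ]
      rw [hqe, show 1 + 2 * x * (-x + ε) + x ^ 2 = M + 2 * x * ε by rw [hMdef]; ring, eq_comm,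
        add_div' _ _ _ h'.ne']
      congr 1
      rw [hMdef]
      ring
    rw [hτ1, hτε] at hcv
    rw [sideIntegral, sideIntegral, ← hcv, ← intervalIntegral.integral_neg]
    refine intervalIntegral.integral_congr fun y hy => ?_
    rw [uIcc_of_le hε1.le] at hy
    have hqy := hqpos y hy
    have hxy : 0 < y + x := by linarith [hy.1]
    have h1y : 0 ≤ 1 - y ^ 2 := by nlinarith [hy.1, hy.2, hx.2]
    have hρ : 0 < M / q y := div_pos hM hqy
    have e1 : 1 - τ y ^ 2 = (M / q y) ^ 2 * (1 - y ^ 2) := by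
      simp only [hτ]
      field_simp
      rw [hqe, hMdef]
      ring
    have e2 : τ y - x = M / q y * (y + x) := by
      simp only [hτ]
      field_simp
      rw [hqe, hMdef]
      ring
    have e3 : quadKernel x (τ y) = M ^ 2 / q y := by
      rw [quadKernel]
      simp only [hτ]
      field_simp
      rw [hqe, hMdef]
      ring
    have e4 : oddKernel x c₀ c₁ (τ y) = (y + x) / M * (c₀ + c₁ * ((y + x) ^ 2 / q y)) := by
      rw [oddKernel, e2, e3]
      congr 1
      · field_simp
      · congr 2
        field_simp
    have e5 : oddKernel x c₀ c₁ (-y) = -((y + x) / q y * (c₀ + c₁ * ((y + x) ^ 2 / q y))) := by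
      rw [oddKernel, quadKernel_neg, ← hq]
      ring
    have e6 : ((M / q y) ^ 2) ^ s * (M / q y) ^ (-1 - 2 * s) = (M / q y)⁻¹ := by
      rw [← Real.rpow_natCast, ← Real.rpow_mul hρ.le, ← Real.rpow_add hρ, ← Real.rpow_neg_one]
      congr 1
      push_cast
      ring
    simp only [Function.comp_apply]
    rw [e1, e2, e4, e5, Real.mul_rpow (sq_nonneg _) h1y, Real.mul_rpow hρ.le hxy.le, sub_neg_eq_add]
    calc _ = -((1 - y ^ 2) ^ s * ((y + x) * (c₀ + c₁ * ((y + x) ^ 2 / q y))) *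
          (y + x) ^ (-1 - 2 * s)) * (1 / q y) := by ring
      _ = -((1 - y ^ 2) ^ s * ((y + x) * (c₀ + c₁ * ((y + x) ^ 2 / q y))) *
          (y + x) ^ (-1 - 2 * s)) * ((M / q y)⁻¹ * (1 / M) * (M ^ 2 / q y ^ 2)) := by
          congr 1
          field_simp
      _ = _ := by rw [← e6]; ring
  · rw [uIcc_of_le hε1.le]
    refine ContinuousOn.div (by fun_prop) (continuous_quadKernel _).continuousOn
      fun y hy => (hqpos y hy).ne'
  · intro y hy
    rw [min_eq_left hε1.le, max_eq_right hε1.le] at hy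
    have hqy := hqpos y ⟨hy.1.le, hy.2.le⟩
    have d1 : HasDerivAt (fun y => 2 * x + (1 + x ^ 2) * y) (1 + x ^ 2) y := by
      simpa using ((hasDerivAt_id y).const_mul (1 + x ^ 2)).const_add (2 * x)
    convert! d1.div (hasDerivAt_quadKernel (-x) y) hqy.ne' using 1
    rw [← hq, hqe, hMdef]
    ring
  · intro y _
    positivity

/-- The finite part vanishes for `oddKernel`: the contributions of the two sides cancel but for the
integral between the truncation points `x + ε` and `x + ε'`, where `ε' - ε = O(ε²)` and the
integrand is `O(ε ^ (-2 s))`. -/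
theorem hasFinitePart_oddKernel {s x : ℝ} (hs : 0 < s) (hs1 : s < 1) (hx : x ∈ Ioo (-1 : ℝ) 1)
    (c₀ c₁ : ℝ) : HasFinitePart s x (oddKernel x c₀ c₁) 0 := by
  have hM : 0 < 1 - x ^ 2 := by nlinarith [hx.1, hx.2]
  set M := 1 - x ^ 2 with hMdef
  have hc : ContinuousOn (fun y => 1 / quadKernel x y *
      (c₀ + c₁ * ((y - x) ^ 2 / quadKernel x y))) (Icc (-1) 1) := by
    have hQ := (continuous_quadKernel x).continuousOn (s := Icc (-1) 1)
    have h0 : ∀ y ∈ Icc (-1 : ℝ) 1, quadKernel x y ≠ 0 := fun y hy => (quadKernel_pos hx hy).ne'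
    fun_prop (disch := assumption)
  obtain ⟨C, hC⟩ := isCompact_Icc.exists_bound_of_continuousOn hc
  have hC0 : 0 ≤ C := (norm_nonneg _).trans (hC x ⟨hx.1.le, hx.2.le⟩)
  have hO : (fun ε : ℝ => C * 2 ^ (2 * s) * (4 / M) * ε ^ 2) =O[𝓝[>] 0] fun ε => ε ^ 2 :=
    (Asymptotics.isBigO_refl _ _).const_mul_left _
  refine squeeze_zero_norm' ?_ (tendsto_rpow_mul_of_isBigO_sq hs1 hO)
  filter_upwards [eventually_small hx, Ioo_mem_nhdsGT (show 0 < M / 4 by positivity),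
    Ioo_mem_nhdsGT (show 0 < (1 - x) / 2 by linarith [hx.2])] with ε ⟨h0, h1, h2⟩ ⟨_, h3⟩ ⟨_, h4⟩
  have hxε : -(M / 2) ≤ 2 * x * ε ∧ 2 * x * ε ≤ M / 2 := by
    constructor <;> nlinarith [hx.1, hx.2]
  have hden : 0 < M + 2 * x * ε := by linarith [hxε.1]
  set ε' := M * ε / (M + 2 * x * ε) with hε'
  have hlow : ε / 2 ≤ ε' := by
    rw [hε', div_le_div_iff₀ (by norm_num) hden]
    nlinarith [hxε.2]
  have hhigh : ε' ≤ 2 * ε := by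
    rw [hε', div_le_iff₀ hden]
    nlinarith [hxε.1]
  have hdiff : |ε - ε'| ≤ 4 / M * ε ^ 2 := by
    have e : ε - ε' = 2 * x * ε ^ 2 / (M + 2 * x * ε) := by
      rw [hε', eq_div_iff hden.ne', sub_mul, div_mul_cancel₀ _ hden.ne']; ring
    rw [e, abs_div, abs_of_pos hden, abs_mul, abs_mul, abs_of_pos (by norm_num : (0 : ℝ) < 2),
      abs_of_nonneg (sq_nonneg ε), div_le_iff₀ hden]
    have hxa : |x| ≤ 1 := abs_le.2 ⟨hx.1.le, hx.2.le⟩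
    calc 2 * |x| * ε ^ 2 ≤ 2 * 1 * ε ^ 2 := by gcongr
      _ = 4 / M * ε ^ 2 * (M / 2) := by field_simp; ring
      _ ≤ 4 / M * ε ^ 2 * (M + 2 * x * ε) := by
        gcongr
        linarith [hxε.1]
  have hε'0 : 0 < ε' := by linarith
  have hcont := continuousOn_sideIntegrand hs hx.1 (half_pos h0) (continuousOn_oddKernel hx c₀ c₁)
  have hint : ∀ δ, ε / 2 ≤ δ → δ ≤ 2 * ε → IntervalIntegrable
      (fun y => (1 - y ^ 2) ^ s * oddKernel x c₀ c₁ y * (y - x) ^ (-1 - 2 * s))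
      MeasureTheory.volume (x + δ) 1 := by
    intro δ hδ hδ'
    refine (hcont.mono ?_).intervalIntegrable
    rw [uIcc_of_le (by linarith)]
    exact Icc_subset_Icc (by linarith) le_rfl
  have hbound := intervalIntegral.norm_integral_le_of_norm_le_const (a := x + ε') (b := x + ε)
    (C := C * (ε / 2) ^ (-2 * s))
    (f := fun y => (1 - y ^ 2) ^ s * oddKernel x c₀ c₁ y * (y - x) ^ (-1 - 2 * s)) ?_
  · have hsplit : sideIntegral s x (oddKernel x c₀ c₁) ε' - sideIntegral s x (oddKernel x c₀ c₁) ε =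
        ∫ y in (x + ε')..(x + ε),
          (1 - y ^ 2) ^ s * oddKernel x c₀ c₁ y * (y - x) ^ (-1 - 2 * s) := by
      have hi := hint ε (by linarith) (by linarith)
      rw [sideIntegral, sideIntegral, ← intervalIntegral.integral_add_adjacent_intervals
        ((hint ε' hlow hhigh).trans hi.symm) hi, add_sub_cancel_right]
    have hx0 : oddKernel x c₀ c₁ x = 0 := by simp [oddKernel]
    rw [truncFinitePart, hx0, sideIntegral_neg_oddKernel hx h0 h2]
    rw [show (1 - x ^ 2) ^ s * 0 * ε ^ (-2 * s) / s - sideIntegral s x (oddKernel x c₀ c₁) ε -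
      -sideIntegral s x (oddKernel x c₀ c₁) ε' = sideIntegral s x (oddKernel x c₀ c₁) ε' -
        sideIntegral s x (oddKernel x c₀ c₁) ε by ring, hsplit]
    refine hbound.trans ?_
    rw [add_sub_add_left_eq_sub]
    have e : (ε / 2) ^ (-2 * s) = ε ^ (-2 * s) * 2 ^ (2 * s) := by
      rw [Real.div_rpow h0.le (by norm_num), show -2 * s = -(2 * s) by ring,
        Real.rpow_neg (by norm_num : (0 : ℝ) ≤ 2), div_inv_eq_mul]
    rw [e]
    calc C * (ε ^ (-2 * s) * 2 ^ (2 * s)) * |ε - ε'|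
        ≤ C * (ε ^ (-2 * s) * 2 ^ (2 * s)) * (4 / M * ε ^ 2) := by gcongr
      _ = _ := by ring
  · intro y hy
    have hyl : ε / 2 ≤ y - x := by
      have : x + ε / 2 < y := lt_of_le_of_lt (le_min (by linarith) (by linarith)) hy.1
      linarith
    have hyr : y ≤ 1 := hy.2.trans (max_le (by linarith) (by linarith))
    have hyx : 0 < y - x := by linarith
    have hyI : y ∈ Icc (-1 : ℝ) 1 := ⟨by linarith [hx.1], hyr⟩
    have h1y : 0 ≤ 1 - y ^ 2 := by nlinarith [hyI.1, hyI.2]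
    have hk : oddKernel x c₀ c₁ y * (y - x) ^ (-1 - 2 * s) = (1 / quadKernel x y *
      (c₀ + c₁ * ((y - x) ^ 2 / quadKernel x y))) * (y - x) ^ (-2 * s) := by
      rw [oddKernel, show -2 * s = -1 - 2 * s + 1 by ring, Real.rpow_add_one hyx.ne']
      ring
    rw [mul_assoc, hk, norm_mul, norm_mul, Real.norm_of_nonneg (Real.rpow_nonneg h1y s),
      Real.norm_of_nonneg (Real.rpow_nonneg hyx.le _)]
    have b1 : (1 - y ^ 2) ^ s ≤ 1 := Real.rpow_le_one h1y (by nlinarith [sq_nonneg y]) hs.le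
    have b2 : (y - x) ^ (-2 * s) ≤ (ε / 2) ^ (-2 * s) :=
      Real.rpow_le_rpow_of_nonpos (by linarith) hyl (by linarith)
    calc _ ≤ 1 * (C * (ε / 2) ^ (-2 * s)) :=
          mul_le_mul b1 (mul_le_mul (hC y hyI) b2 (Real.rpow_nonneg hyx.le _) hC0)
            (mul_nonneg (norm_nonneg _) (Real.rpow_nonneg hyx.le _)) zero_le_one
      _ = _ := one_mul _

/-! ### Beta integrals and monomials -/

theorem integral_one_sub_rpow_mul_rpow {s r : ℝ} (hs : 0 < s) (hs1 : s < 1) (hr : 0 < r)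
    (hr1 : r < 1) :
    ∫ u in r..1, (1 - u) ^ s * u ^ (-1 - s) =
      ((1 - r) / r) ^ s / s - ∫ u in r..1, u ^ (1 - s - 1) * (1 - u) ^ (s - 1) := by
  have hi1 : IntervalIntegrable (fun u : ℝ => (1 - u) ^ s * u ^ (-1 - s))
      MeasureTheory.volume r 1 := by
    refine ContinuousOn.intervalIntegrable ?_
    rw [uIcc_of_le hr1.le]
    refine ContinuousOn.mul ?_ ?_
    · exact ContinuousOn.rpow_const (by fun_prop) fun y _ => Or.inr hs.le
    · exact ContinuousOn.rpow_const (by fun_prop) fun y hy => Or.inl (by linarith [hy.1])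
  have hi2 : IntervalIntegrable (fun u : ℝ => u ^ (1 - s - 1) * (1 - u) ^ (s - 1))
      MeasureTheory.volume r 1 := by
    refine (beta_moment (a := 1 - s) (b := s) (by linarith) hs).1.mono_set ?_
    rw [uIcc_of_le hr1.le, uIcc_of_le zero_le_one]
    exact Icc_subset_Icc hr.le le_rfl
  rw [eq_sub_iff_add_eq, ← intervalIntegral.integral_add hi1 hi2,
    intervalIntegral.integral_eq_sub_of_hasDerivAt_of_le (f := fun u =>
    -((1 - u) ^ s * u ^ (-s) / s)) hr1.le ?_ ?_ (hi1.add hi2)]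
  · rw [Real.div_rpow (by linarith) hr.le, Real.rpow_neg hr.le, sub_self, Real.zero_rpow hs.ne']
    ring
  · refine ((ContinuousOn.mul ?_ ?_).div_const _).neg
    · exact ContinuousOn.rpow_const (by fun_prop) fun y _ => Or.inr hs.le
    · exact ContinuousOn.rpow_const (by fun_prop) fun y hy => Or.inl (by linarith [hy.1])
  · intro u hu
    have hu0 : 0 < u := hr.trans hu.1
    have hu1 : 0 < 1 - u := by linarith [hu.2]
    have d1 : HasDerivAt (fun u : ℝ => (1 - u) ^ s) (-1 * s * (1 - u) ^ (s - 1)) u :=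
      ((hasDerivAt_id u).const_sub 1).rpow_const (Or.inl hu1.ne')
    have d2 : HasDerivAt (fun u : ℝ => u ^ (-s)) (1 * -s * u ^ (-s - 1)) u :=
      (hasDerivAt_id u).rpow_const (Or.inl hu0.ne')
    convert! ((d1.mul d2).div_const s).neg using 1
    rw [show 1 - s - 1 = -s by ring, show -1 - s = -s - 1 by ring]
    field_simp
    ring

/-- The change of variables `ζ = (y - x)² / Q`, for which `1 - ζ = (1 - y²) / Q`, turns one side of
the integral into an incomplete Beta integral. -/
theorem sideIntegral_evenKernel {s x ε : ℝ} (hs : 0 < s) (hs1 : s < 1) (hx : x ∈ Ioo (-1 : ℝ) 1)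
    (hε : 0 < ε) (hε1 : x + ε < 1) :
    sideIntegral s x (fun y => (1 - x * y) / quadKernel x y) ε =
      (1 - (x + ε) ^ 2) ^ s * ε ^ (-2 * s) / (2 * s) -
        (∫ u in (ε ^ 2 / quadKernel x (x + ε))..1, u ^ (1 - s - 1) * (1 - u) ^ (s - 1)) / 2 := by
  have hI : ∀ y ∈ Icc (x + ε) 1, y ∈ Icc (-1 : ℝ) 1 := fun y hy => ⟨by linarith [hy.1, hx.1], hy.2⟩
  have hQ : ∀ y ∈ Icc (x + ε) 1, 0 < quadKernel x y := fun y hy => quadKernel_pos hx (hI y hy)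
  have hxy : ∀ y ∈ Icc (x + ε) 1, 0 < 1 - x * y := by
    intro y hy
    have h1 := hQ y hy
    rw [quadKernel] at h1
    nlinarith [hx.1, hx.2]
  set ζ : ℝ → ℝ := fun y => (y - x) ^ 2 / quadKernel x y with hζ
  have hcv := intervalIntegral.integral_comp_mul_deriv_of_deriv_nonneg (a := x + ε) (b := 1)
    (f := ζ) (f' := fun y => 2 * (y - x) * (1 - x * y) / quadKernel x y ^ 2)
    (g := fun u => (1 - u) ^ s * u ^ (-1 - s)) ?_ ?_ ?_
  · have hζ1 : ζ 1 = 1 := by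
      have h := hQ 1 ⟨hε1.le, le_rfl⟩
      simp only [hζ]
      rw [div_eq_one_iff_eq h.ne', quadKernel]
      ring
    have hQε := hQ (x + ε) ⟨le_rfl, hε1.le⟩
    have h1ε : 0 < 1 - (x + ε) ^ 2 := by nlinarith [hx.1]
    have hζε : ζ (x + ε) = ε ^ 2 / quadKernel x (x + ε) := by
      simp only [hζ, add_sub_cancel_left]
    have hr : 0 < ε ^ 2 / quadKernel x (x + ε) := div_pos (pow_pos hε 2) hQε
    have hone : quadKernel x (x + ε) = 1 - (x + ε) ^ 2 + ε ^ 2 := by rw [quadKernel]; ring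
    have hr1 : ε ^ 2 / quadKernel x (x + ε) < 1 := by
      rw [div_lt_one hQε, hone]
      linarith
    have hratio : (1 - ε ^ 2 / quadKernel x (x + ε)) / (ε ^ 2 / quadKernel x (x + ε)) =
        (1 - (x + ε) ^ 2) / ε ^ 2 := by
      field_simp
      rw [hone]
      ring
    rw [hζ1, hζε, integral_one_sub_rpow_mul_rpow hs hs1 hr hr1, hratio] at hcv
    have hpow : ((1 - (x + ε) ^ 2) / ε ^ 2) ^ s = (1 - (x + ε) ^ 2) ^ s * ε ^ (-2 * s) := by
      rw [Real.div_rpow h1ε.le (sq_nonneg _), ← Real.rpow_natCast ε 2, ← Real.rpow_mul hε.le,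
        div_eq_mul_inv, ← Real.rpow_neg hε.le]
      congr 2
      push_cast
      ring
    rw [hpow] at hcv
    have hside : sideIntegral s x (fun y => (1 - x * y) / quadKernel x y) ε = 1 / 2 *
        ∫ y in (x + ε)..1, ((fun u : ℝ => (1 - u) ^ s * u ^ (-1 - s)) ∘ ζ) y *
          (2 * (y - x) * (1 - x * y) / quadKernel x y ^ 2) := by
      rw [sideIntegral, ← intervalIntegral.integral_const_mul]
      refine intervalIntegral.integral_congr fun y hy => ?_
      rw [uIcc_of_le hε1.le] at hy
      have hQy := hQ y hy
      have hd : 0 < y - x := by linarith [hy.1]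
      have h1y : 0 ≤ 1 - y ^ 2 := by nlinarith [(hI y hy).1, (hI y hy).2]
      have e1 : 1 - ζ y = (1 - y ^ 2) / quadKernel x y := by
        simp only [hζ]
        field_simp
        rw [quadKernel]
        ring
      have e2 : ((y - x) ^ 2) ^ (-1 - s) = (y - x) ^ (-1 - 2 * s) * (y - x)⁻¹ := by
        rw [← Real.rpow_natCast, ← Real.rpow_mul hd.le, ← Real.rpow_neg_one (y - x),
          ← Real.rpow_add hd]
        congr 1
        push_cast
        ring
      have e3 : quadKernel x y ^ (-1 - s) = (quadKernel x y)⁻¹ * (quadKernel x y ^ s)⁻¹ := by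
        rw [← Real.rpow_neg_one, ← Real.rpow_neg hQy.le, ← Real.rpow_add hQy, sub_eq_add_neg]
      have hQs : 0 < quadKernel x y ^ s := Real.rpow_pos_of_pos hQy s
      simp only [Function.comp_apply]
      rw [e1, Real.div_rpow h1y hQy.le]
      simp only [hζ]
      rw [Real.div_rpow (sq_nonneg _) hQy.le, e2, e3]
      field_simp
    rw [hside, hcv]
    ring
  · rw [uIcc_of_le hε1.le]
    exact ContinuousOn.div (by fun_prop) (continuous_quadKernel _).continuousOn
      fun y hy => (hQ y hy).ne'
  · intro y hy
    rw [min_eq_left hε1.le, max_eq_right hε1.le] at hy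
    have hQy := hQ y ⟨hy.1.le, hy.2.le⟩
    have d1 : HasDerivAt (fun y => (y - x) ^ 2) (2 * (y - x)) y := by
      simpa using ((hasDerivAt_id y).sub_const x).fun_pow 2
    convert! d1.div (hasDerivAt_quadKernel x y) hQy.ne' using 1
    congr 1
    rw [quadKernel]
    ring
  · intro y hy
    rw [min_eq_left hε1.le, max_eq_right hε1.le] at hy
    have hQy := hQ y ⟨hy.1.le, hy.2.le⟩
    have := hxy y ⟨hy.1.le, hy.2.le⟩
    have : 0 < y - x := by linarith [hy.1]
    positivity

theorem tendsto_incomplete_beta {s x : ℝ} (hs : 0 < s) (hs1 : s < 1) (hx : x ∈ Ioo (-1 : ℝ) 1) :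
    Tendsto (fun ε : ℝ => ∫ u in (ε ^ 2 / quadKernel x (x + ε))..1,
      u ^ (1 - s - 1) * (1 - u) ^ (s - 1)) (𝓝[>] 0) (𝓝 (Real.Gamma (1 - s) * Real.Gamma s)) := by
  obtain ⟨hi, hv⟩ := beta_moment (a := 1 - s) (b := s) (by linarith) hs
  rw [sub_add_cancel, Real.Gamma_one, div_one] at hv
  rw [← hv]
  have hc := intervalIntegral.continuousOn_primitive_interval_left
    (f := fun u : ℝ => u ^ (1 - s - 1) * (1 - u) ^ (s - 1)) (μ := MeasureTheory.volume)
    (a := 0) (b := 1) ((intervalIntegrable_iff' (by simp)).1 hi)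
  have h0 := hc 0 left_mem_uIcc
  refine Tendsto.comp h0 (tendsto_nhdsWithin_iff.2 ⟨?_, ?_⟩)
  · have hcont : ContinuousAt (fun ε : ℝ => ε ^ 2 / quadKernel x (x + ε)) 0 := by
      refine ContinuousAt.div (by fun_prop)
        ((continuous_quadKernel x).continuousAt.comp (by fun_prop)) ?_
      rw [add_zero]
      exact (quadKernel_pos hx ⟨hx.1.le, hx.2.le⟩).ne'
    have := hcont.tendsto
    simp only [ne_eq, OfNat.ofNat_ne_zero, not_false_eq_true, zero_pow, zero_div] at this
    exact this.mono_left nhdsWithin_le_nhds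
  · filter_upwards [eventually_small hx] with ε ⟨h0, h1, h2⟩
    have hQ : 0 < quadKernel x (x + ε) := quadKernel_pos hx ⟨by linarith [hx.1], h1.le⟩
    rw [uIcc_of_le zero_le_one]
    refine ⟨by positivity, ?_⟩
    rw [div_le_one hQ, quadKernel]
    nlinarith [hx.1]

theorem hasFinitePart_evenKernel {s x : ℝ} (hs : 0 < s) (hs1 : s < 1) (hx : x ∈ Ioo (-1 : ℝ) 1) :
    HasFinitePart s x (fun y => (1 - x * y) / quadKernel x y)
      (Real.Gamma (1 - s) * Real.Gamma s) := by
  have hx' : -x ∈ Ioo (-1 : ℝ) 1 := ⟨by linarith [hx.2], by linarith [hx.1]⟩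
  have h1x : 0 < 1 - x ^ 2 := by nlinarith [hx.1, hx.2]
  have hψ : ContDiffAt ℝ 2 (fun y : ℝ => (1 - y ^ 2) ^ s) x :=
    ContDiffAt.rpow_const_of_ne (f := fun y : ℝ => 1 - y ^ 2) (by fun_prop) h1x.ne'
  have hlim := (((tendsto_rpow_mul_second_difference hs1 hψ).const_mul (-1 / (2 * s))).add
    ((tendsto_incomplete_beta hs hs1 hx).div_const 2)).add
    ((tendsto_incomplete_beta hs hs1 hx').div_const 2)
  rw [mul_zero, zero_add, add_halves] at hlim
  refine hlim.congr' ?_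
  filter_upwards [eventually_small hx] with ε ⟨h0, h1, h2⟩
  have hneg : (fun y => (1 - x * -y) / quadKernel x (-y)) =
      fun y => (1 - -x * y) / quadKernel (-x) y := by
    funext y
    rw [quadKernel_neg]
    ring
  have hQx : quadKernel x x = 1 - x * x := by rw [quadKernel]; ring
  rw [truncFinitePart, hneg, sideIntegral_evenKernel hs hs1 hx h0 h1,
    sideIntegral_evenKernel hs hs1 hx' h0 h2, hQx, div_self (by nlinarith),
    show (-x + ε) ^ 2 = (x - ε) ^ 2 by ring]
  field_simp
  ring

/-- The constant `1` is `(1 - x y) / Q - x (y - x) / Q`. -/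
theorem hasFinitePart_one {s x : ℝ} (hs : 0 < s) (hs1 : s < 1) (hx : x ∈ Ioo (-1 : ℝ) 1) :
    HasFinitePart s x (fun _ => 1) (Real.Gamma (1 - s) * Real.Gamma s) := by
  have hQ0 : ∀ y ∈ Icc (-1 : ℝ) 1, quadKernel x y ≠ 0 := fun y hy => (quadKernel_pos hx hy).ne'
  have hQc := (continuous_quadKernel x).continuousOn (s := Icc (-1) 1)
  have h := (hasFinitePart_evenKernel hs hs1 hx).add hs hx
    (hasFinitePart_oddKernel hs hs1 hx (-x) 0) (by fun_prop (disch := assumption))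
    (continuousOn_oddKernel hx _ _)
  rw [add_zero] at h
  refine h.congr hx fun y hy => ?_
  have := hQ0 y hy
  simp only [oddKernel]
  field_simp
  rw [quadKernel]
  ring

/-- Up to a total derivative (with `q = 1 / Q`) and an odd term, the identity function equals the
constant `(1 + 2 s) x`. -/
theorem hasFinitePart_id {s x : ℝ} (hs : 0 < s) (hs1 : s < 1) (hx : x ∈ Ioo (-1 : ℝ) 1) :
    HasFinitePart s x (fun y => y) ((1 + 2 * s) * x * (Real.Gamma (1 - s) * Real.Gamma s)) := by
  have hQ0 : ∀ y ∈ Icc (-1 : ℝ) 1, quadKernel x y ≠ 0 := fun y hy => (quadKernel_pos hx hy).ne'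
  have hQc := (continuous_quadKernel x).continuousOn (s := Icc (-1) 1)
  have hQ2 : ∀ y ∈ Icc (-1 : ℝ) 1, quadKernel x y ^ 2 ≠ 0 := fun y hy => pow_ne_zero 2 (hQ0 y hy)
  have hq : ∀ y ∈ Icc (-1 : ℝ) 1, HasDerivAt (fun y => (quadKernel x y)⁻¹)
      (2 * x / quadKernel x y ^ 2) y := by
    intro y hy
    convert! (hasDerivAt_quadKernel x y).inv (hQ0 y hy) using 1
    ring
  have hqc : ContinuousOn (fun y => (quadKernel x y)⁻¹) (Icc (-1) 1) := by
    fun_prop (disch := assumption)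
  have hqc' : ContinuousOn (fun y => 2 * x / quadKernel x y ^ 2) (Icc (-1) 1) := by
    fun_prop (disch := assumption)
  have hq2 : ContDiffAt ℝ 2 (fun y => (quadKernel x y)⁻¹) x := by
    refine ContDiffAt.inv ?_ (hQ0 x ⟨hx.1.le, hx.2.le⟩)
    unfold quadKernel
    fun_prop
  have h1 := (hasFinitePart_ibpOp hs hs1 hx hq hqc' hq2).const_mul (-x)
  have h2 := hasFinitePart_oddKernel hs hs1 hx (1 - x ^ 2 + 2 * s * x ^ 2) (2 * x ^ 2)
  have h3 := (hasFinitePart_one hs hs1 hx).const_mul ((1 + 2 * s) * x)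
  have hc1 : ContinuousOn (fun y => -x * ibpOp s x (fun y => (quadKernel x y)⁻¹)
      (fun y => 2 * x / quadKernel x y ^ 2) y) (Icc (-1) 1) :=
    (continuousOn_ibpOp s x hqc hqc').const_mul _
  have hc2 := continuousOn_oddKernel hx (1 - x ^ 2 + 2 * s * x ^ 2) (2 * x ^ 2)
  have h := (h1.add hs hx h2 hc1 hc2).add hs hx h3 (hc1.add hc2) continuousOn_const
  rw [mul_zero, add_zero, zero_add] at h
  refine h.congr hx fun y hy => ?_
  have := hQ0 y hy
  simp only [oddKernel, ibpOp]
  field_simp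
  simp only [quadKernel]
  ring

open Polynomial in
theorem hasFinitePart_pow {s x : ℝ} (hs : 0 < s) (hs1 : s < 1) (hx : x ∈ Ioo (-1 : ℝ) 1) (k : ℕ) :
    HasFinitePart s x (fun y => y ^ k)
      (Real.Gamma (1 - s) * Real.Gamma s * (kernelPoly s k).eval x) := by
  set K := Real.Gamma (1 - s) * Real.Gamma s with hK
  induction k using Nat.strong_induction_on with
  | _ k ih =>
    rcases k with _ | _ | k
    · simpa [kernelPoly_zero] using hasFinitePart_one hs hs1 hx
    · have := hasFinitePart_id hs hs1 hx
      rw [← hK] at this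
      simp only [zero_add, pow_one, kernelPoly_one, eval_mul, eval_C, eval_X]
      convert this using 1
      ring
    · -- the derivative of `y ^ k` contributes the lower power `k - 1` with a factor `k`
      have hd : ∀ y ∈ Icc (-1 : ℝ) 1, HasDerivAt (fun y : ℝ => y ^ k) (k * y ^ (k - 1)) y :=
        fun y _ => hasDerivAt_pow k y
      have h0 := hasFinitePart_ibpOp hs hs1 hx hd (by fun_prop) (by fun_prop)
      have h1 := (ih (k + 1) (by omega)).const_mul ((k + 2 + 2 * s) * x)
      have h2 := (ih k (by omega)).const_mul (k - 2 * s)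
      have h3 : HasFinitePart s x (fun y => -(k * x) * y ^ (k - 1))
          (-(k * x) * (K * (kernelPoly s (k - 1)).eval x)) := (ih (k - 1) (by omega)).const_mul _
      have hc0 := continuousOn_ibpOp (S := Icc (-1) 1) s x
        (q := fun y => y ^ k) (q' := fun y => k * y ^ (k - 1)) (by fun_prop) (by fun_prop)
      have h := (((h0.add hs hx h1 hc0 (by fun_prop)).add hs hx h2
        (hc0.add (by fun_prop)) (by fun_prop)).add hs hx h3
        ((hc0.add (by fun_prop)).add (by fun_prop)) (by fun_prop)).const_mul (1 / (k + 2))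
      have hk2 : (k : ℝ) + 2 ≠ 0 := by positivity
      have hrec := congrArg (eval x) (kernelPoly_recurrence s k)
      simp only [eval_mul, eval_add, eval_sub, eval_C, eval_X] at hrec
      have hL : 1 / ((k : ℝ) + 2) *
          (0 + (k + 2 + 2 * s) * x * (K * (kernelPoly s (k + 1)).eval x) +
          (k - 2 * s) * (K * (kernelPoly s k).eval x) +
          -(k * x) * (K * (kernelPoly s (k - 1)).eval x)) =
          K * (kernelPoly s (k + 1 + 1)).eval x := by
        rw [one_div_mul_eq_div, div_eq_iff hk2]
        linear_combination -K * hrec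
      rw [← hL]
      refine h.congr hx fun y _ => ?_
      simp only [ibpOp]
      rw [one_div_mul_eq_div, div_eq_iff hk2]
      rcases k with _ | k
      · simp; ring
      · rw [Nat.add_sub_cancel]; push_cast; ring

open Polynomial in
theorem hasFinitePart_eval {s x : ℝ} (hs : 0 < s) (hs1 : s < 1) (hx : x ∈ Ioo (-1 : ℝ) 1)
    (p : ℝ[X]) : HasFinitePart s x (fun y => p.eval y)
      (Real.Gamma (1 - s) * Real.Gamma s * (kernelMap s p).eval x) := by
  induction p using Polynomial.induction_on' with
  | add p q hp hq =>
    simp only [map_add, eval_add, mul_add]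
    exact hp.add hs hx hq p.continuousOn q.continuousOn
  | monomial k a =>
    simp only [kernelMap_monomial, eval_mul, eval_C, eval_monomial]
    have := (hasFinitePart_pow hs hs1 hx k).const_mul a
    rwa [mul_left_comm] at this

/-! ### The fractional Laplacian -/

open MeasureTheory

/-- The truncated integral on one side, for a continuous function that vanishes to the right
of `1`. -/
theorem integral_Ioi_sub_div_rpow {s x c C ε : ℝ} (hs : 0 < s) (hε : 0 < ε) {u : ℝ → ℝ}
    (hu : Continuous u) (hC : ∀ y, |u y| ≤ C) (h0 : ∀ y, 1 ≤ y → u y = 0) :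
    IntegrableOn (fun t => (c - u (x + t)) / t ^ (1 + 2 * s)) (Ioi ε) ∧
    (x + ε < 1 → ∫ t in Ioi ε, (c - u (x + t)) / t ^ (1 + 2 * s) =
      c * ε ^ (-2 * s) / (2 * s) - ∫ y in (x + ε)..1, u y * (y - x) ^ (-1 - 2 * s)) := by
  have hexp : -1 - 2 * s < -1 := by linarith
  have hi0 := integrableOn_Ioi_rpow_of_lt hexp hε
  have hi1 : IntegrableOn (fun t => c * t ^ (-1 - 2 * s)) (Ioi ε) := hi0.const_mul c
  have hi2 : IntegrableOn (fun t => u (x + t) * t ^ (-1 - 2 * s)) (Ioi ε) := by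
    refine Integrable.bdd_mul (c := C) hi0 ?_ (Eventually.of_forall fun t => hC _)
    exact (hu.comp (by fun_prop)).aestronglyMeasurable
  have hEq : EqOn (fun t => c * t ^ (-1 - 2 * s) - u (x + t) * t ^ (-1 - 2 * s))
      (fun t => (c - u (x + t)) / t ^ (1 + 2 * s)) (Ioi ε) := by
    intro t ht
    have ht0 : 0 < t := hε.trans ht
    simp only
    rw [show -1 - 2 * s = -(1 + 2 * s) by ring, Real.rpow_neg ht0.le]
    ring
  refine ⟨(hi1.sub hi2).congr_fun hEq measurableSet_Ioi, fun hε1 => ?_⟩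
  rw [← setIntegral_congr_fun measurableSet_Ioi hEq, integral_sub hi1 hi2, integral_const_mul,
    integral_Ioi_rpow_of_lt hexp hε]
  congr 1
  · rw [show -1 - 2 * s + 1 = -2 * s by ring]
    field_simp
  · have hle : ε ≤ 1 - x := by linarith
    have hsplit : ∫ t in Ioi ε, u (x + t) * t ^ (-1 - 2 * s) =
        ∫ t in Ioc ε (1 - x), u (x + t) * t ^ (-1 - 2 * s) := by
      refine setIntegral_eq_of_subset_of_forall_sdiff_eq_zero measurableSet_Ioi
        Ioc_subset_Ioi_self fun t ht => ?_
      have : 1 - x < t := by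
        by_contra hc
        exact ht.2 ⟨ht.1, not_lt.1 hc⟩
      rw [h0 _ (by linarith), zero_mul]
    rw [hsplit, ← intervalIntegral.integral_of_le hle]
    have := intervalIntegral.integral_comp_add_left (a := ε) (b := 1 - x)
      (fun y => u y * (y - x) ^ (-1 - 2 * s)) x
    simp only [add_sub_cancel_left, add_sub_cancel] at this
    exact this

theorem compl_Ioo_neg_eq {ε : ℝ} : (Ioo (-ε) ε)ᶜ = Iic (-ε) ∪ Ici ε := by
  ext t
  simp only [mem_compl_iff, mem_Ioo, mem_union, mem_Iic, mem_Ici, not_and_or, not_lt]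

theorem integral_compl_Ioo_sub_div_rpow {s x C ε : ℝ} (hs : 0 < s) (hε : 0 < ε) {u : ℝ → ℝ}
    (hu : Continuous u) (hC : ∀ y, |u y| ≤ C) (h0 : ∀ y, 1 ≤ |y| → u y = 0) :
    IntegrableOn (fun t => (u x - u (x - t)) / |t| ^ (1 + 2 * s)) (Ioo (-ε) ε)ᶜ ∧
    (x + ε < 1 → -x + ε < 1 → ∫ t in (Ioo (-ε) ε)ᶜ, (u x - u (x - t)) / |t| ^ (1 + 2 * s) =
      u x * ε ^ (-2 * s) / s - (∫ y in (x + ε)..1, u y * (y - x) ^ (-1 - 2 * s)) -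
        ∫ y in (-x + ε)..1, u (-y) * (y - -x) ^ (-1 - 2 * s)) := by
  obtain ⟨hr, hr'⟩ := integral_Ioi_sub_div_rpow (x := x) (c := u x) hs hε hu hC
    fun y hy => h0 y (hy.trans (le_abs_self y))
  obtain ⟨hl, hl'⟩ := integral_Ioi_sub_div_rpow (u := fun y => u (-y)) (x := -x) (c := u x) hs hε
    (hu.comp continuous_neg) (fun y => hC _)
    fun y hy => h0 (-y) (by rw [abs_neg]; exact hy.trans (le_abs_self y))
  set f : ℝ → ℝ := fun t => (u x - u (x - t)) / |t| ^ (1 + 2 * s) with hf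
  have hpos : EqOn (fun t => (u x - u (-(-x + t))) / t ^ (1 + 2 * s)) f (Ioi ε) := by
    intro t ht
    have ht0 : 0 < t := hε.trans ht
    simp only [hf]
    rw [abs_of_pos ht0, show -(-x + t) = x - t by ring]
  have hneg : EqOn (fun t => (u x - u (x + t)) / t ^ (1 + 2 * s)) (fun t => f (-t)) (Ioi ε) := by
    intro t ht
    have ht0 : 0 < t := hε.trans ht
    simp only [hf]
    rw [abs_neg, abs_of_pos ht0, sub_neg_eq_add]
  have hiR : IntegrableOn f (Ici ε) :=
    (integrableOn_Ici_iff_integrableOn_Ioi (by finiteness)).2 (hl.congr_fun hpos measurableSet_Ioi)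
  have hiL : IntegrableOn f (Iic (-ε)) := by
    have h1 : IntegrableOn (fun t => f (-t)) (Ici ε) :=
      (integrableOn_Ici_iff_integrableOn_Ioi (by finiteness)).2
        (hr.congr_fun hneg measurableSet_Ioi)
    have h2 := h1.comp_neg
    simpa using h2
  rw [compl_Ioo_neg_eq]
  refine ⟨hiL.union hiR, fun h1 h2 => ?_⟩
  have hdisj : Disjoint (Iic (-ε)) (Ici ε) := by
    rw [Set.disjoint_left]
    intro t ht ht'
    have := mem_Iic.1 ht
    have := mem_Ici.1 ht'
    linarith
  rw [setIntegral_union hdisj measurableSet_Ici hiL hiR, ← integral_comp_neg_Ioi,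
    integral_Ici_eq_integral_Ioi, ← setIntegral_congr_fun measurableSet_Ioi hpos,
    ← setIntegral_congr_fun measurableSet_Ioi hneg, hr' h1, hl' h2]
  field_simp
  ring

/-- The constant of the fractional Laplacian, by the duplication formula. -/
theorem gamma_mul_gamma_div_eta {s : ℝ} (hs : 0 < s) (hs1 : s < 1) :
    1 / fracLaplacianEta (2 * s) * (Real.Gamma (1 - s) * Real.Gamma s) =
      Real.Gamma (2 * s + 1) := by
  have h1 : Real.Gamma (1 - s) = -s * Real.Gamma (-s) := by
    rw [← Real.Gamma_add_one (by linarith : -s ≠ 0), neg_add_eq_sub]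
  have h2 : Real.Gamma (2 * s + 1) = 2 * s * Real.Gamma (2 * s) :=
    Real.Gamma_add_one (by linarith)
  have h3 := Real.Gamma_mul_Gamma_add_half s
  have h4 : Real.Gamma (-s) ≠ 0 := by
    intro h
    rw [h, mul_zero] at h1
    exact (Real.Gamma_pos_of_pos (by linarith : 0 < 1 - s)).ne' h1
  have h5 : (2 : ℝ) ^ (1 - 2 * s) * 2 ^ (2 * s) = 2 := by
    rw [← Real.rpow_add (by norm_num), sub_add_cancel, Real.rpow_one]
  have h6 : Real.sqrt Real.pi ≠ 0 := (Real.sqrt_pos.2 Real.pi_pos).ne'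
  have h7 : (2 : ℝ) ^ (2 * s) ≠ 0 := (Real.rpow_pos_of_pos (by norm_num) _).ne'
  have h8 : Real.Gamma (s + 1 / 2) ≠ 0 := (Real.Gamma_pos_of_pos (by linarith)).ne'
  rw [fracLaplacianEta, h1, h2, show 2 * s / 2 = s by ring,
    show (1 + 2 * s) / 2 = s + 1 / 2 by ring]
  generalize Real.Gamma (s + 1 / 2) = a at *
  generalize Real.Gamma (2 * s) = b at *
  generalize (2 : ℝ) ^ (2 * s) = c at *
  field_simp
  linear_combination c * h3 + b * Real.sqrt Real.pi * h5

/-- The case of order `2 s < 2`. -/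
theorem hasFracLaplacianAt_of_lt_two {s : ℝ} (hs : 0 < s) (hs1 : s < 1) (n : ℕ) {x : ℝ}
    (hx : x ∈ Ioo (-1 : ℝ) 1) :
    HasFracLaplacianAt (2 * s) (fun z : ℝ => (max (1 - z ^ 2) 0) ^ s * (jacobi s s n).eval z) x
      (Real.Gamma ((n : ℝ) + 2 * s + 1) / Real.Gamma ((n : ℝ) + 1) * (jacobi s s n).eval x) := by
  set P := jacobi s s n with hP
  set u : ℝ → ℝ := fun z => (max (1 - z ^ 2) 0) ^ s * P.eval z with hu
  have hcont : Continuous u := by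
    refine Continuous.mul ?_ P.continuous
    exact Continuous.rpow_const (by fun_prop) fun z => Or.inr hs.le
  have hzero : ∀ y, 1 ≤ |y| → u y = 0 := by
    intro y hy
    have : 1 - y ^ 2 ≤ 0 := by
      rw [← sq_abs]
      nlinarith
    simp only [hu]
    rw [max_eq_right this, Real.zero_rpow hs.ne', zero_mul]
  have hval : ∀ y ∈ Icc (-1 : ℝ) 1, u y = (1 - y ^ 2) ^ s * P.eval y := by
    intro y hy
    simp only [hu]
    rw [max_eq_left (by nlinarith [hy.1, hy.2])]
  obtain ⟨C, hC⟩ : ∃ C, ∀ y, |u y| ≤ C := by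
    obtain ⟨C, hC⟩ := isCompact_Icc.exists_bound_of_continuousOn
      (hcont.continuousOn (s := Icc (-1) 1))
    refine ⟨C, fun y => ?_⟩
    rcases le_total |y| 1 with h | h
    · exact hC y (abs_le.1 h)
    · rw [hzero y h, abs_zero]
      exact (norm_nonneg _).trans (hC 0 (by simp))
  refine Or.inr ⟨by linarith, fun ε hε =>
    (integral_compl_Ioo_sub_div_rpow hs hε hcont hC hzero).1, ?_⟩
  have hfp : Tendsto (truncFinitePart s x fun y => P.eval y) _ _ := hasFinitePart_eval hs hs1 hx P
  have hlim := hfp.const_mul (1 / fracLaplacianEta (2 * s))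
  have hL : 1 / fracLaplacianEta (2 * s) *
      (Real.Gamma (1 - s) * Real.Gamma s * (kernelMap s P).eval x) =
      Real.Gamma ((n : ℝ) + 2 * s + 1) / Real.Gamma ((n : ℝ) + 1) * P.eval x := by
    rw [← mul_assoc, gamma_mul_gamma_div_eta hs hs1, hP, kernelMap_jacobi (by linarith),
      Polynomial.eval_mul, Polynomial.eval_C, Real.Gamma_nat_eq_factorial,
      show (n : ℝ) + 2 * s + 1 = 1 + 2 * s + n by ring, gamma_add_nat_eq (by linarith),
      add_comm (2 * s) 1]
    ring
  rw [hL] at hlim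
  refine hlim.congr' ?_
  filter_upwards [eventually_small hx] with ε ⟨h0, h1, h2⟩
  have hr : ∫ y in (x + ε)..1, u y * (y - x) ^ (-1 - 2 * s) =
      sideIntegral s x (fun y => P.eval y) ε := by
    refine intervalIntegral.integral_congr fun y hy => ?_
    rw [uIcc_of_le h1.le] at hy
    simp only [hval y ⟨by linarith [hy.1, hx.1], hy.2⟩]
  have hl : ∫ y in (-x + ε)..1, u (-y) * (y - -x) ^ (-1 - 2 * s) =
      sideIntegral s (-x) (fun y => P.eval (-y)) ε := by
    refine intervalIntegral.integral_congr fun y hy => ?_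
    rw [uIcc_of_le h2.le] at hy
    simp only [hval (-y) ⟨by linarith [hy.2], by linarith [hy.1, hx.2]⟩, neg_sq]
  rw [(integral_compl_Ioo_sub_div_rpow hs h0 hcont hC hzero).2 h1 h2, truncFinitePart, hr, hl,
    hval x ⟨hx.1.le, hx.2.le⟩]

/-- The case of order `2`, where the claim is the Gegenbauer differential equation. -/
theorem hasFracLaplacianAt_two (n : ℕ) {x : ℝ} (hx : x ∈ Ioo (-1 : ℝ) 1) :
    HasFracLaplacianAt 2 (fun z : ℝ => (max (1 - z ^ 2) 0) ^ (1 : ℝ) * (jacobi 1 1 n).eval z) x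
      (Real.Gamma ((n : ℝ) + 2 + 1) / Real.Gamma ((n : ℝ) + 1) * (jacobi 1 1 n).eval x) := by
  set P := jacobi 1 1 n with hP
  set W : Polynomial ℝ := (1 - Polynomial.X ^ 2) * P with hW
  have hWe : ∀ z ∈ Ioo (-1 : ℝ) 1, (max (1 - z ^ 2) 0) ^ (1 : ℝ) * P.eval z = W.eval z := by
    intro z hz
    rw [Real.rpow_one, max_eq_left (by nlinarith [hz.1, hz.2]), hW]
    simp
  refine Or.inl ⟨rfl, fun z => W.derivative.eval z, ?_, ?_⟩
  · filter_upwards [Ioo_mem_nhds hx.1 hx.2] with z hz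
    refine (W.hasDerivAt z).congr_of_eventuallyEq ?_
    filter_upwards [Ioo_mem_nhds hz.1 hz.2] with t ht using hWe t ht
  · refine (W.derivative.hasDerivAt x).congr_deriv ?_
    have hode := congrArg (Polynomial.eval x) (gegenbauerOp_jacobi (s := 1) (by norm_num) n)
    rw [gegenbauerOp_apply, ← hP] at hode
    have hΓ : Real.Gamma ((n : ℝ) + 2 + 1) / Real.Gamma ((n : ℝ) + 1) = (n + 2) * (n + 1) := by
      have h1 : (n : ℝ) + 1 ≠ 0 := by positivity
      have h2 : (n : ℝ) + 2 ≠ 0 := by positivity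
      rw [Real.Gamma_add_one h2, show (n : ℝ) + 2 = n + 1 + 1 by ring, Real.Gamma_add_one h1]
      have h3 : Real.Gamma ((n : ℝ) + 1) ≠ 0 := (Real.Gamma_pos_of_pos (by positivity)).ne'
      field_simp
    rw [hΓ, hW]
    simp only [Polynomial.derivative_mul, Polynomial.derivative_add, Polynomial.derivative_sub,
      Polynomial.derivative_one, Polynomial.derivative_X_pow, Polynomial.eval_mul,
      Polynomial.eval_add, Polynomial.eval_sub, Polynomial.eval_C, Polynomial.eval_X,
      Polynomial.eval_one, Polynomial.eval_pow, Polynomial.derivative_C,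
      Polynomial.derivative_zero, Polynomial.eval_zero, Nat.cast_ofNat] at hode ⊢
    norm_num at hode ⊢
    linear_combination hode

end FinitePart

theorem theorem2p1 (α : ℝ) (hα0 : 0 < α) (hα2 : α ≤ 2) (n : ℕ) (x : ℝ)
    (hx : x ∈ Set.Ioo (-1 : ℝ) 1) :
    HasFracLaplacianAt α
      (fun z : ℝ => (max (1 - z ^ 2) 0) ^ (α / 2) * (jacobi (α / 2) (α / 2) n).eval z) x
      (Real.Gamma ((n : ℝ) + α + 1) / Real.Gamma ((n : ℝ) + 1) *
        (jacobi (α / 2) (α / 2) n).eval x) := by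
  rcases hα2.eq_or_lt with rfl | hlt
  · have := hasFracLaplacianAt_two n hx
    rwa [show (2 : ℝ) / 2 = 1 by norm_num]
  · have := hasFracLaplacianAt_of_lt_two (s := α / 2) (by linarith) (by linarith) n hx
    rwa [mul_div_cancel₀ α two_ne_zero] at this
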